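/- Consider one energy transmitter (ET, agent $0$), $K\ge 2$ energy users (EUs, agents $1,\dots,K$) and $N$ channels. Let $\mathcal P=\{p\in\mathbb R^N:\sum_n p_n\le P_{\max},\ 0\le p_n\le P_{\mathrm{peak},n}\ \forall n\}$ with $P_{\max}>0$ and $P_{\mathrm{peak},n}>0$. EU $k$ has channel gains $h_{k,n}\ge 0$, received power $q_k(p)=\sum_n h_{k,n}p_n$, and a strictly concave, increasing, continuous real utility $U_k$ on an interval $D_k\supseteq(0,\infty)$, with $0\in D_k$ if $h_k=0$, such that $U_k$, extended by $-\infty$ outside $D_k$, is upper semicontinuous on $\mathbb R$ (for example $D_k=\mathbb R$, $D_k=[0,\infty)$, or $U_k(q)=\log q$ with $h_k\ne0$). The ET has a cost $C$ that is nonnegative, increasing, convex and continuously differentiable on $[0,\infty)^N$. Neither $C$ nor the functions $p\mapsto U_k(q_k(p))$ need be strictly convex or strictly concave in $p$. Write $\omega(k)=k \bmod (K+1)$. MPAT Game: every agent $k\in\{0,\dots,K\}$ sends a message $m_k=(\gamma_k,b_k)\in\mathbb R^{N}\times\mathbb R^{N}$. The transmit power is $p_n(m)=\frac1{K+1}\sum_{k}\gamma_{k,n}$,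 the tax rates are $R_{k,n}(m)=b_{\omega(k+1),n}-b_{\omega(k+2),n}$ and the taxes are $t_{k,n}(m)=R_{k,n}(m)\,p_n(m)$. The payoff is $J_k(p,t_k)=U_k(q_k(p))-\sum_n t_{k,n}$ for an EU, and for the ET it is $J_0(p,t_0)=-C(p)-\sum_n t_{0,n}$ if $p\in\mathcal P$ and $-\infty$ otherwise. A message profile is a Nash equilibrium (NE) if no agent can increase his payoff by changing only his own message. For $\rho>0$ let, for $\pi,\beta\in\mathbb R^{(K+1)\times N}$, $$\mathcal L_\rho(\pi,\beta)=\sum_{k=1}^K U_k(q_k(\pi_k))-C(\pi_0)-\sum_{k=0}^{K}\sum_{n}\Big[\pi_{k,n}\big(\beta_{k,n}-\beta_{\omega(k+1),n}\big)+\tfrac{\rho}{2}\big(\pi_{k,n}-\pi_{\omega(k-1),n}\big)^2\Big],$$ the augmented Lagrangian of the problem of maximizing $\sum_{k=1}^K U_k(q_k(\pi_k))-C(\pi_0)$ subject to $\pi_k=\pi_{\omega(k-1)}$ for all $k$ and $\pi_0\in\mathcal P$. A saddle point of $\mathcal L_\rho$ is a pair $(\pi^*,\beta^*)$ with $\pi^*_0\in\mathcal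 P$ and $\mathcal L_\rho(\pi,\beta^*)\le\mathcal L_\rho(\pi^*,\beta^*)\le\mathcal L_\rho(\pi^*,\beta)$ for all $\pi$ with $\pi_0\in\mathcal P$ and all $\beta$. D-MPAT Algorithm, with $\rho=1$ and $\sigma=1/4$: from an arbitrary message profile $m(0)$, all agents $k$ update simultaneously, for $\tau=0,1,2,\dots$, $$\gamma_k(\tau+1)=\gamma_k(\tau)+\sigma(\hat\gamma_k(\tau)-\gamma_k(\tau)),\qquad b_k(\tau+1)=b_k(\tau)+\rho\sigma\big(\gamma_{\omega(k-1)}(\tau)-\gamma_{\omega(k-2)}(\tau)\big),$$ where $\hat\gamma_k(\tau)$ maximizes $J_k\big(p,(R_{k,n}(m(\tau))p_n)_n\big)-\frac{\rho}{2}\sum_n\big(p_n-\gamma_{\omega(k-1),n}(\tau)\big)^2$ over $p\in\mathbb R^N$ if $k\ge1$ and over $p\in\mathcal P$ if $k=0$. Theorem. (i) For every $\rho>0$ and every saddle point $(\pi^*,\beta^*)$ of $\mathcal L_\rho$, the message profile $\gamma_{k,n}=\pi^*_{k,n}$, $b_{k,n}=\beta^*_{\omega(k-1),n}$ is an NE of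 the MPAT Game. (ii) From every initial message profile, the D-MPAT Algorithm generates exactly one sequence $m(\tau)$, and this sequence converges, as $\tau\to\infty$, to a message profile of the form $\gamma_{k,n}=\pi^*_{k,n}$, $b_{k,n}=\beta^*_{\omega(k-1),n}$ for some saddle point $(\pi^*,\beta^*)$ of $\mathcal L_1$; in particular, it converges to an NE of the MPAT Game. -/

import Mathlib

/-- The data of a wireless power transfer system with `K` energy users (EUs) and `N` channels:
the utility `U k` of EU `k` on its domain `dom k`, his channel gains `h k`, the cost `C` of the
energy transmitter (ET), her total power bound `Pmax` and her peak power bounds `Ppeak n`. -/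
structure WPTSystem (K N : ℕ) where
  dom : Fin K → Set ℝ
  U : Fin K → ℝ → ℝ
  h : Fin K → Fin N → ℝ
  C : (Fin N → ℝ) → ℝ
  Pmax : ℝ
  Ppeak : Fin N → ℝ

/-- A profile of one vector in `ℝ^N` per agent. Agent `0` is the ET, agent `j.succ` is EU `j`.
Addition and subtraction in `Fin (K + 1)` are modulo `K + 1`. -/
abbrev AgentVec (K N : ℕ) : Type := Fin (K + 1) → Fin N → ℝ

/-- A message profile: agent `k` sends `m k = (γ_k, b_k)`, his power and price proposals. -/
abbrev MessageProfile (K N : ℕ) : Type := Fin (K + 1) → (Fin N → ℝ) × (Fin N → ℝ)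

namespace WPTSystem

variable {K N : ℕ} (S : WPTSystem K N)

/-- The feasible transmit powers of the ET. -/
def powerSet : Set (Fin N → ℝ) :=
  {p | ∑ n, p n ≤ S.Pmax ∧ ∀ n, 0 ≤ p n ∧ p n ≤ S.Ppeak n}

/-- The received power `q_k(p)` of EU `k`. -/
def received (k : Fin K) (p : Fin N → ℝ) : ℝ := ∑ n, S.h k n * p n

open Classical in
/-- The utility of EU `k` as a function of the received power, `-∞` outside its domain. -/
noncomputable def utility (k : Fin K) (q : ℝ) : EReal :=
  if q ∈ S.dom k then (S.U k q : EReal) else ⊥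

/-- The standing assumptions of the model. -/
structure Standing : Prop where
  /-- Utilities are defined at least for positive received power ... -/
  dom_pos : ∀ k, Set.Ioi 0 ⊆ S.dom k
  /-- ... and at zero, for an EU who can receive no power at all. -/
  dom_zero : ∀ k, S.h k = 0 → (0 : ℝ) ∈ S.dom k
  U_strictConcave : ∀ k, StrictConcaveOn ℝ (S.dom k) (S.U k)
  U_increasing : ∀ k, MonotoneOn (S.U k) (S.dom k)
  U_continuous : ∀ k, ContinuousOn (S.U k) (S.dom k)
  /-- The domain is natural: at an endpoint that it omits, the utility tends to `-∞`.
  (Nothing is required where the domain is `ℝ` or `[0, ∞)`.) -/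
  U_closed : ∀ k, UpperSemicontinuous (S.utility k)
  h_nonneg : ∀ k n, 0 ≤ S.h k n
  C_nonneg : ∀ p, 0 ≤ p → 0 ≤ S.C p
  C_increasing : MonotoneOn S.C {p | 0 ≤ p}
  C_convex : ConvexOn ℝ {p | 0 ≤ p} S.C
  C_contDiff : ContDiffOn ℝ 1 S.C {p | 0 ≤ p}
  Pmax_pos : 0 < S.Pmax
  Ppeak_pos : ∀ n, 0 < S.Ppeak n

/-- `-C(p)` for the ET and `U_k(q_k(p))` for EU `k`. -/
noncomputable def valuation (k : Fin (K + 1)) (p : Fin N → ℝ) : EReal :=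
  Fin.cases (motive := fun _ => EReal) ((-S.C p : ℝ) : EReal)
    (fun j => S.utility j (S.received j p)) k

/-- The constraint set of agent `k`'s own maximization: the feasible powers for the ET,
all of `ℝ^N` for an EU. -/
def feasible (k : Fin (K + 1)) : Set (Fin N → ℝ) :=
  {p | k = 0 → p ∈ S.powerSet}

open Classical in
/-- The payoff `J_k(p, t_k)`. -/
noncomputable def payoff (k : Fin (K + 1)) (p t : Fin N → ℝ) : EReal :=
  if p ∈ S.feasible k then S.valuation k p - ((∑ n, t n : ℝ) : EReal) else ⊥

/-- The transmit power of the MPAT mechanism: the average of the power proposals. -/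
noncomputable def transmitPower (m : MessageProfile K N) (n : Fin N) : ℝ :=
  (1 / ((K : ℝ) + 1)) * ∑ k, (m k).1 n

/-- The tax rate `R_{k,n} = b_{ω(k+1),n} - b_{ω(k+2),n}` of the MPAT mechanism. -/
def taxRate (m : MessageProfile K N) (k : Fin (K + 1)) (n : Fin N) : ℝ :=
  (m (k + 1)).2 n - (m (k + 2)).2 n

/-- The tax `t_{k,n} = R_{k,n} p_n` of the MPAT mechanism. -/
noncomputable def tax (m : MessageProfile K N) (k : Fin (K + 1)) (n : Fin N) : ℝ :=
  taxRate m k n * transmitPower m n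

/-- The payoff of agent `k` in the MPAT game at the message profile `m`. -/
noncomputable def gamePayoff (m : MessageProfile K N) (k : Fin (K + 1)) : EReal :=
  S.payoff k (transmitPower m) (tax m k)

/-- Nash equilibria of the MPAT game. -/
def IsNashEquilibrium (m : MessageProfile K N) : Prop :=
  ∀ (k : Fin (K + 1)) (mk : (Fin N → ℝ) × (Fin N → ℝ)),
    S.gamePayoff (Function.update m k mk) k ≤ S.gamePayoff m k

/-- Agent `k`'s local augmented Lagrangian of the reformulated problem
`max ∑_k U_k(q_k(π_k)) - C(π_0)` subject to `π_k = π_{ω(k-1)}` for all `k` and `π_0` feasible. -/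
noncomputable def localAugLagrangian (ρ : ℝ) (π β : AgentVec K N) (k : Fin (K + 1)) : EReal :=
  S.valuation k (π k) -
    ((∑ n, (π k n * (β k n - β (k + 1) n) + ρ / 2 * (π k n - π (k - 1) n) ^ 2) : ℝ) : EReal)

/-- The augmented Lagrangian. -/
noncomputable def augLagrangian (ρ : ℝ) (π β : AgentVec K N) : EReal :=
  ∑ k, S.localAugLagrangian ρ π β k

/-- Saddle points of the augmented Lagrangian over `{π | π_0 feasible}` and all `β`. -/
def IsSaddlePoint (ρ : ℝ) (π β : AgentVec K N) : Prop :=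
  π 0 ∈ S.powerSet ∧
  (∀ π' : AgentVec K N, π' 0 ∈ S.powerSet →
    S.augLagrangian ρ π' β ≤ S.augLagrangian ρ π β) ∧
  (∀ β' : AgentVec K N, S.augLagrangian ρ π β ≤ S.augLagrangian ρ π β')

/-- The message profile `γ_k = π_k`, `b_k = β_{ω(k-1)}`. -/
def messageOf (π β : AgentVec K N) : MessageProfile K N := fun k => (π k, β (k - 1))

/-- What agent `k` maximizes over `p` in an iteration with current messages `m`: the payoff under
his current tax rate, minus a quadratic penalty for deviating from agent `ω(k-1)`'s proposal. -/
noncomputable def penalizedPayoff (ρ : ℝ) (m : MessageProfile K N) (k : Fin (K + 1))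
    (p : Fin N → ℝ) : EReal :=
  S.payoff k p (fun n => taxRate m k n * p n) -
    ((∑ n, ρ / 2 * (p n - (m (k - 1)).1 n) ^ 2 : ℝ) : EReal)

/-- The profile `m'` results from the profile `m` by one synchronous iteration of the D-MPAT algorithm with
parameters `ρ` and `σ`. -/
def IsStep (ρ σ : ℝ) (m m' : MessageProfile K N) : Prop :=
  ∃ γhat : AgentVec K N, ∀ k,
    (γhat k ∈ S.feasible k ∧
      IsMaxOn (S.penalizedPayoff ρ m k) (S.feasible k) (γhat k)) ∧
    (∀ n, (m' k).1 n = (m k).1 n + σ * (γhat k n - (m k).1 n)) ∧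
    (∀ n, (m' k).2 n = (m k).2 n + ρ * σ * ((m (k - 1)).1 n - (m (k - 2)).1 n))

/-- A run of the D-MPAT algorithm: the sequence of message profiles that it produces. -/
def IsRun (ρ σ : ℝ) (m : ℕ → MessageProfile K N) : Prop :=
  ∀ τ, S.IsStep ρ σ (m τ) (m (τ + 1))

end WPTSystem

open Matrix

namespace WPTSystem

variable {K N : ℕ}

/-- The Euclidean inner product of two profiles of vectors. -/
def ip (x y : AgentVec K N) : ℝ := ∑ k, x k ⬝ᵥ y k

/-- The cyclic shift that assigns to each agent the vector of the preceding agent. -/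
def prev (x : AgentVec K N) : AgentVec K N := fun k => x (k - 1)

/-- The cyclic shift that assigns to each agent the vector of the following agent. -/
def next (x : AgentVec K N) : AgentVec K N := fun k => x (k + 1)

lemma ip_comm (x y : AgentVec K N) : ip x y = ip y x := by
  simp [ip, dotProduct_comm]

lemma ip_add_left (x y z : AgentVec K N) : ip (x + y) z = ip x z + ip y z := by
  simp [ip, add_dotProduct, Finset.sum_add_distrib]

lemma ip_sub_left (x y z : AgentVec K N) : ip (x - y) z = ip x z - ip y z := by
  simp [ip, sub_dotProduct, Finset.sum_sub_distrib]

lemma ip_neg_left (x z : AgentVec K N) : ip (-x) z = -ip x z := by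
  simp [ip, neg_dotProduct, Finset.sum_neg_distrib]

lemma ip_smul_left (c : ℝ) (x z : AgentVec K N) : ip (c • x) z = c * ip x z := by
  simp [ip, smul_dotProduct, Finset.mul_sum]

lemma ip_add_right (x y z : AgentVec K N) : ip z (x + y) = ip z x + ip z y := by
  rw [ip_comm, ip_add_left, ip_comm x, ip_comm y]

lemma ip_sub_right (x y z : AgentVec K N) : ip z (x - y) = ip z x - ip z y := by
  rw [ip_comm, ip_sub_left, ip_comm x, ip_comm y]

lemma ip_neg_right (x z : AgentVec K N) : ip z (-x) = -ip z x := by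
  rw [ip_comm, ip_neg_left, ip_comm x]

lemma ip_smul_right (c : ℝ) (x z : AgentVec K N) : ip z (c • x) = c * ip z x := by
  rw [ip_comm, ip_smul_left, ip_comm x]

lemma dotProduct_self_nonneg' (v : Fin N → ℝ) : 0 ≤ v ⬝ᵥ v :=
  Finset.sum_nonneg fun n _ => mul_self_nonneg (v n)

lemma ip_self_nonneg (x : AgentVec K N) : 0 ≤ ip x x :=
  Finset.sum_nonneg fun k _ => dotProduct_self_nonneg' (x k)

lemma sq_le_ip_self (x : AgentVec K N) (k : Fin (K + 1)) (n : Fin N) : x k n ^ 2 ≤ ip x x := by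
  have h1 : x k n ^ 2 ≤ x k ⬝ᵥ x k := by
    rw [sq]
    exact Finset.single_le_sum (f := fun n => x k n * x k n)
      (fun i _ => mul_self_nonneg _) (Finset.mem_univ n)
  exact h1.trans (Finset.single_le_sum (f := fun k => x k ⬝ᵥ x k)
    (fun i _ => dotProduct_self_nonneg' _) (Finset.mem_univ k))

lemma prev_add (x y : AgentVec K N) : prev (x + y) = prev x + prev y := rfl
lemma prev_sub (x y : AgentVec K N) : prev (x - y) = prev x - prev y := rfl
lemma prev_smul (c : ℝ) (x : AgentVec K N) : prev (c • x) = c • prev x := rfl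
lemma next_add (x y : AgentVec K N) : next (x + y) = next x + next y := rfl
lemma next_sub (x y : AgentVec K N) : next (x - y) = next x - next y := rfl
lemma next_smul (c : ℝ) (x : AgentVec K N) : next (c • x) = c • next x := rfl

lemma next_prev (x : AgentVec K N) : next (prev x) = x := by
  funext k; simp [next, prev]

lemma prev_next (x : AgentVec K N) : prev (next x) = x := by
  funext k; simp [next, prev]

lemma ip_prev_prev (x y : AgentVec K N) : ip (prev x) (prev y) = ip x y :=
  Equiv.sum_comp (Equiv.subRight (1 : Fin (K + 1))) (fun k => x k ⬝ᵥ y k)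

lemma ip_next_left (x y : AgentVec K N) : ip (next x) y = ip x (prev y) := by
  have := Equiv.sum_comp (Equiv.addRight (1 : Fin (K + 1))) (fun k => x k ⬝ᵥ y (k - 1))
  simpa [ip, next, prev] using this

lemma ip_next_right (x y : AgentVec K N) : ip x (next y) = ip (prev x) y := by
  rw [ip_comm, ip_next_left, ip_comm]

/-- The quadratic part of the Lyapunov function: `e` is the deviation of the proposals, `μ` that
of the multipliers, `u` the last displacement of the local maximizers from the proposals. -/
noncomputable def lyap (e u μ : AgentVec K N) : ℝ :=
  2 * ip (μ + (e - prev e)) (μ + (e - prev e)) + 2 * ip e e + 16 / 5 * ip u e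
    - 4 / 5 * ip (u - prev u) e + 1 / 5 * ip (u - prev u) (e - prev e)
    + 8 / 5 * ip u u + 3 / 10 * ip (e - prev e) (e - prev e)

lemma lyap_lower (e u μ : AgentVec K N) :
    3 / 10 * ip e e + 2 * ip (μ + (e - prev e)) (μ + (e - prev e)) ≤ lyap e u μ := by
  have h1 := ip_self_nonneg ((17 / 5 : ℝ) • e + ((14 / 5 : ℝ) • u + (3 / 5 : ℝ) • prev u
    - (1 / 5 : ℝ) • next u))
  have h2 := ip_self_nonneg (u - prev u)
  have h3 := ip_self_nonneg (prev u + next u)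
  have h4 := ip_self_nonneg (e - prev e)
  have h5 := ip_self_nonneg u
  have c1 := ip_comm u (prev u)
  have c2 := ip_comm e (prev e)
  have c3 := ip_comm u (prev e)
  have c4 := ip_comm e (prev u)
  have c5 := ip_comm u (prev (prev u))
  have c6 := ip_comm e u
  simp only [lyap, ip_add_left, ip_add_right, ip_sub_left, ip_sub_right, ip_smul_left,
    ip_smul_right, ip_prev_prev, ip_next_left, ip_next_right, prev_add, prev_sub, prev_smul,
    prev_next] at *
  linarith

lemma lyap_descent (e d u μ : AgentVec K N) :
    lyap (e + (1 / 4 : ℝ) • d) d (μ + (1 / 4 : ℝ) • (e - prev e)) - lyap e u μ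
      + 16 / 5 * ip (-(d - u + (1 / 4 : ℝ) • (u - prev u)
          + (1 / 4 : ℝ) • ((e - (1 / 4 : ℝ) • u) - prev (e - (1 / 4 : ℝ) • u)
            - next ((e - (1 / 4 : ℝ) • u) - prev (e - (1 / 4 : ℝ) • u))))) (e + d)
      + ip (-((μ - next μ) + d + (e - prev e))) (e + d)
    ≤ -(1 / 80 * (ip (e - prev e) (e - prev e) + ip d d)) := by
  have h1 := ip_self_nonneg ((e - prev e) + (5 / 8 : ℝ) • d)
  have h2 := ip_self_nonneg ((16 / 5 : ℝ) • (d - u) - ((3 / 5 : ℝ) • (d - next d)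
    - (1 / 5 : ℝ) • (d - prev d)))
  have h3 := ip_self_nonneg ((d - prev d) + (d - next d))
  have h4 := ip_self_nonneg (d - prev d)
  have h5 := ip_self_nonneg d
  have h6 := ip_self_nonneg (e - prev e)
  have c1 := ip_comm u (prev u)
  have c2 := ip_comm e (prev e)
  have c3 := ip_comm d (prev d)
  have c4 := ip_comm e (prev u)
  have c5 := ip_comm u (prev e)
  have c6 := ip_comm e u
  have c7 := ip_comm d (prev u)
  have c8 := ip_comm u (prev d)
  have c9 := ip_comm d u
  have c10 := ip_comm e (prev d)
  have c11 := ip_comm d (prev e)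
  have c12 := ip_comm e d
  have c13 := ip_comm e μ
  have c14 := ip_comm d μ
  have c15 := ip_comm e (prev μ)
  have c16 := ip_comm d (prev μ)
  have c17 := ip_comm μ (prev e)
  have c18 := ip_comm μ (prev d)
  have c19 := ip_comm d (prev (prev d))
  simp only [lyap, ip_add_left, ip_add_right, ip_sub_left, ip_sub_right, ip_smul_left,
    ip_smul_right, ip_neg_left, ip_prev_prev, ip_next_left, ip_next_right, prev_add, prev_sub,
    prev_smul, next_sub, next_smul, next_prev, prev_next] at *
  linarith

end WPTSystem

/-- `F` is a convex function on the domain `D`, with closed epigraph. -/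
structure IsClosedConvex {N : ℕ} (D : Set (Fin N → ℝ)) (F : (Fin N → ℝ) → ℝ) : Prop where
  convexOn : ConvexOn ℝ D F
  isClosed : IsClosed {q : (Fin N → ℝ) × ℝ | q.1 ∈ D ∧ F q.1 ≤ q.2}

/-- `g` is a subgradient at `x ∈ D` of the function `F` with domain `D`. -/
def IsSubgradient {N : ℕ} (D : Set (Fin N → ℝ)) (F : (Fin N → ℝ) → ℝ) (x g : Fin N → ℝ) : Prop :=
  x ∈ D ∧ ∀ y ∈ D, F x + g ⬝ᵥ (y - x) ≤ F y

lemma nonneg_of_forall_nonneg_add_mul {a b : ℝ}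
    (h : ∀ t : ℝ, 0 < t → t ≤ 1 → 0 ≤ a + t * b) : 0 ≤ a := by
  by_contra! ha
  have hb : 0 < b := by have := h 1 one_pos le_rfl; linarith
  have h1 := h (min 1 (-a / (2 * b))) (lt_min one_pos (by apply div_pos <;> linarith))
    (min_le_left _ _)
  have h2 : min 1 (-a / (2 * b)) * b ≤ -a / 2 := by
    calc min 1 (-a / (2 * b)) * b ≤ -a / (2 * b) * b := by gcongr; exact min_le_right _ _
      _ = -a / 2 := by field_simp
  linarith

lemma exists_pos_smul_add_mem_of_mem_interior {V : Type*} [NormedAddCommGroup V] [NormedSpace ℝ V]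
    {D : Set V} {x : V} (hx : x ∈ interior D) (v : V) : ∃ δ : ℝ, 0 < δ ∧ x + δ • v ∈ D := by
  have hc : Filter.Tendsto (fun δ : ℝ => x + δ • v) (nhdsWithin 0 (Set.Ioi 0)) (nhds x) := by
    have : Continuous fun δ : ℝ => x + δ • v := by fun_prop
    simpa using (this.tendsto 0).mono_left nhdsWithin_le_nhds
  obtain ⟨δ, h1, h2⟩ := ((hc.eventually (mem_interior_iff_mem_nhds.1 hx)).and
    self_mem_nhdsWithin).exists
  exact ⟨δ, h2, h1⟩

/-- A minimizer of a convex function along a subspace that meets the interior of its domain has a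
subgradient that vanishes on the subspace. -/
theorem ConvexOn.exists_multiplier {V : Type*} [NormedAddCommGroup V] [NormedSpace ℝ V]
    [FiniteDimensional ℝ V] {D : Set V} {F : V → ℝ} (hF : ConvexOn ℝ D F) (W : Submodule ℝ V)
    {xs x0 : V} (hx0 : x0 ∈ interior D) (hW : x0 - xs ∈ W)
    (hmin : ∀ y ∈ D, y - xs ∈ W → F xs ≤ F y) :
    ∃ φ : V →L[ℝ] ℝ, (∀ w ∈ W, φ w = 0) ∧ ∀ y ∈ D, F xs + φ (y - xs) ≤ F y := by
  have hx0D := interior_subset hx0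
  have ht : Convex ℝ {q : V × ℝ | q.1 - xs ∈ W ∧ q.2 ≤ F xs} := by
    rintro ⟨x, s⟩ ⟨hx, hs⟩ ⟨y, t⟩ ⟨hy, ht⟩ a b ha hb hab
    refine ⟨?_, ?_⟩
    · have : (a • (x, s) + b • (y, t)).1 - xs = a • (x - xs) + b • (y - xs) := by
        have h : xs = (a + b) • xs := by rw [hab, one_smul]
        simp only [Prod.smul_mk, Prod.mk_add_mk]
        nth_rewrite 1 [h]
        module
      simp only [this]
      exact W.add_mem (W.smul_mem _ hx) (W.smul_mem _ hy)
    · simp only [Prod.smul_mk, Prod.mk_add_mk, smul_eq_mul] at *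
      calc a * s + b * t ≤ a * F xs + b * F xs := by gcongr
        _ = F xs := by rw [← add_mul, hab, one_mul]
  have hop : IsOpen ((interior D ×ˢ Set.univ) ∩
      (fun q : V × ℝ => q.2 - F q.1) ⁻¹' (Set.Ioi 0)) := by
    refine ContinuousOn.isOpen_inter_preimage ?_ (isOpen_interior.prod isOpen_univ) isOpen_Ioi
    exact continuousOn_snd.sub
      (hF.continuousOn_interior.comp continuousOn_fst fun q hq => hq.1)
  have hsub : ((interior D ×ˢ Set.univ) ∩ (fun q : V × ℝ => q.2 - F q.1) ⁻¹' (Set.Ioi 0)) ⊆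
      {q : V × ℝ | q.1 ∈ D ∧ F q.1 < q.2} := fun q hq =>
    ⟨interior_subset hq.1.1, by simpa using hq.2⟩
  obtain ⟨f, u, hf, h1, h2⟩ := geometric_hahn_banach_of_nonempty_interior
    hF.convex_strict_epigraph ht
    (Set.disjoint_left.2 fun q hq hq' => by
      have hq := interior_subset hq
      exact absurd (hmin q.1 hq.1 hq'.1) (not_le.2 (hq.2.trans_le hq'.2)))
    ⟨(x0, F x0 + 1), interior_maximal hsub hop ⟨⟨hx0, trivial⟩, by simp⟩⟩
    ⟨(xs, F xs), by simp⟩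
  set φ : V →L[ℝ] ℝ := f.comp (ContinuousLinearMap.inl ℝ V ℝ) with hφ
  set c : ℝ := f (0, 1) with hc
  have hfx : ∀ x t, f (x, t) = φ x + c * t := fun x t => by
    have : (x, t) = (x, 0) + t • ((0 : V), (1 : ℝ)) := by simp
    rw [this, map_add, map_smul, hφ, hc, smul_eq_mul, mul_comm]
    rfl
  have hs : ∀ y ∈ D, φ y + c * F y ≤ u := fun y hy => by
    have h3 : 0 ≤ u - (φ y + c * F y) := nonneg_of_forall_nonneg_add_mul (b := -c) fun t h _ => by
      have := h1 (y, F y + t) ⟨hy, by simpa using h⟩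
      rw [hfx] at this
      linarith
    linarith
  have hxs : u ≤ φ xs + c * F xs := by
    have := h2 (xs, F xs) (by simp)
    rwa [hfx] at this
  have hx0u : u ≤ φ x0 + c * F xs := by
    have := h2 (x0, F xs) (by simpa using hW)
    rwa [hfx] at this
  have hc0 : c ≤ 0 := by
    have h3 := h1 (x0, F x0 + 1) ⟨hx0D, by simp⟩
    rw [hfx] at h3
    have := hmin x0 hx0D hW
    by_contra! h
    nlinarith
  have hcne : c ≠ 0 := fun h0 => by
    apply hf
    have hφ0 : ∀ v, φ v ≤ 0 := fun v => by
      obtain ⟨δ, hδ, hD⟩ := exists_pos_smul_add_mem_of_mem_interior hx0 v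
      have := hs _ hD
      simp only [h0, map_add, map_smul, smul_eq_mul, zero_mul, add_zero] at this hx0u
      by_contra! h
      nlinarith [mul_pos hδ h]
    refine ContinuousLinearMap.ext fun q => ?_
    have ha := hφ0 q.1
    have hb := hφ0 (-q.1)
    rw [map_neg] at hb
    change f (q.1, q.2) = 0
    rw [hfx, h0]
    linarith
  have hcneg : c < 0 := lt_of_le_of_ne hc0 hcne
  have hW0 : ∀ w ∈ W, 0 ≤ φ w := fun w hw => by
    by_contra! h
    have := h2 (xs + ((φ xs + c * F xs - u + 1) / (-φ w)) • w, F xs)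
      ⟨by simpa using W.smul_mem _ hw, le_rfl⟩
    rw [hfx, map_add, map_smul, smul_eq_mul, div_mul_eq_mul_div, mul_div_assoc, div_neg,
      div_self h.ne] at this
    linarith
  refine ⟨(-c)⁻¹ • φ, fun w hw => ?_, fun y hy => ?_⟩
  · have ha := hW0 w hw
    have hb := hW0 (-w) (W.neg_mem hw)
    rw [map_neg] at hb
    have : φ w = 0 := by linarith
    simp [this]
  · have h3 : φ (y - xs) ≤ (-c) * (F y - F xs) := by
      rw [map_sub]; linarith [hs y hy]
    have h4 : (-c)⁻¹ * φ (y - xs) ≤ F y - F xs := by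
      rw [inv_mul_le_iff₀ (by linarith)]; exact h3
    simp only [_root_.smul_apply, smul_eq_mul]
    linarith

lemma exists_dotProduct_eq {N : ℕ} (φ : (Fin N → ℝ) →ₗ[ℝ] ℝ) :
    ∃ g : Fin N → ℝ, ∀ v, φ v = g ⬝ᵥ v := by
  refine ⟨fun n => φ (Pi.single n 1), fun v => ?_⟩
  rw [LinearMap.pi_apply_eq_sum_univ φ v]
  simp only [dotProduct, smul_eq_mul, mul_comm]
  refine Finset.sum_congr rfl fun n _ => ?_
  congr 2
  funext j
  simp [Pi.single_apply, eq_comm]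

lemma ConvexOn.exists_isSubgradient {N : ℕ} {D : Set (Fin N → ℝ)} {F : (Fin N → ℝ) → ℝ}
    (hF : ConvexOn ℝ D F) {x : Fin N → ℝ} (hx : x ∈ interior D) :
    ∃ g, IsSubgradient D F x g := by
  obtain ⟨φ, -, h⟩ := hF.exists_multiplier ⊥ hx (xs := x) (by simp) (fun y _ hy => by
    rw [Submodule.mem_bot, sub_eq_zero] at hy; rw [hy])
  obtain ⟨g, hg⟩ := exists_dotProduct_eq φ.toLinearMap
  exact ⟨g, interior_subset hx, fun y hy => by rw [← hg]; exact h y hy⟩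

/-- The subdifferential sum rule at a minimizer of a sum of convex functions whose domains have a
common interior point. -/
theorem exists_isSubgradient_sum_eq_zero {ι : Type*} [Fintype ι] {N : ℕ}
    {D : ι → Set (Fin N → ℝ)} {F : ι → (Fin N → ℝ) → ℝ} (hF : ∀ i, ConvexOn ℝ (D i) (F i))
    {x0 xs : Fin N → ℝ} (hx0 : ∀ i, x0 ∈ interior (D i)) (hxs : ∀ i, xs ∈ D i)
    (hmin : ∀ y, (∀ i, y ∈ D i) → ∑ i, F i xs ≤ ∑ i, F i y) :
    ∃ g : ι → Fin N → ℝ, ∑ i, g i = 0 ∧ ∀ i, IsSubgradient (D i) (F i) xs (g i) := by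
  classical
  let W : Submodule ℝ (ι → Fin N → ℝ) :=
    LinearMap.range (LinearMap.pi fun _ => LinearMap.id : (Fin N → ℝ) →ₗ[ℝ] ι → Fin N → ℝ)
  have hG : ConvexOn ℝ (Set.univ.pi D) (fun π => ∑ i, F i (π i)) := by
    refine ⟨convex_pi fun i _ => (hF i).1, fun x hx y hy a b ha hb hab => ?_⟩
    simp only [smul_eq_mul, Finset.mul_sum, ← Finset.sum_add_distrib]
    exact Finset.sum_le_sum fun i _ => (hF i).2 (hx i trivial) (hy i trivial) ha hb hab
  obtain ⟨φ, hφW, hφ⟩ := hG.exists_multiplier W (x0 := fun _ => x0) (xs := fun _ => xs)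
    (by rw [interior_pi_set Set.finite_univ]; exact fun i _ => hx0 i)
    ⟨x0 - xs, rfl⟩
    (fun y hy hyW => by
      obtain ⟨v, hv⟩ := hyW
      have hyv : y = fun _ => xs + v := by
        funext i
        have := congrFun hv i
        simp only [LinearMap.pi_apply, LinearMap.id_apply, Pi.sub_apply] at this
        rw [this]; abel
      rw [hyv] at hy ⊢
      exact hmin _ fun i => hy i trivial)
  choose g hg using fun i => exists_dotProduct_eq
    (φ.toLinearMap.comp (LinearMap.single ℝ (fun _ : ι => Fin N → ℝ) i))
  refine ⟨g, ?_, fun i => ⟨hxs i, fun y hy => ?_⟩⟩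
  · refine dotProduct_eq _ _ fun v => ?_
    rw [zero_dotProduct, sum_dotProduct]
    simp only [← hg]
    have h0 := hφW (fun _ => v) ⟨v, rfl⟩
    have h1 : (fun _ : ι => v) = ∑ i, Pi.single i v := by
      funext j; simp [Finset.sum_apply, Pi.single_apply]
    rw [h1, map_sum] at h0
    simpa using h0
  · have h1 := hφ (Function.update (fun _ => xs) i y) (fun j _ => by
      by_cases h : j = i
      · subst h; simpa using hy
      · simpa [Function.update_of_ne h] using hxs j)
    have h2 : Function.update (fun _ => xs) i y - (fun _ => xs) = Pi.single i (y - xs) := by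
      funext j
      by_cases h : j = i
      · subst h; simp
      · simp [h]
    have h3 : ∀ p : Fin N → ℝ, ∑ j, F j (Function.update (fun _ => xs) i p j) =
        F i p + ∑ j ∈ Finset.univ.erase i, F j xs := fun p => by
      rw [← Finset.add_sum_erase _ _ (Finset.mem_univ i), Function.update_self]
      congr 1
      refine Finset.sum_congr rfl fun j hj => ?_
      rw [Function.update_of_ne (Finset.ne_of_mem_erase hj)]
    have h4 : ∑ j, F j xs = F i xs + ∑ j ∈ Finset.univ.erase i, F j xs :=
      (Finset.add_sum_erase _ (fun j => F j xs) (Finset.mem_univ i)).symm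
    rw [h2, h3, h4] at h1
    have h5 : g i ⬝ᵥ (y - xs) = φ (Pi.single i (y - xs)) := (hg i _).symm
    rw [h5]
    linarith

lemma neg_sq_sub_le_dotProduct {N : ℕ} (v w : Fin N → ℝ) :
    -(v ⬝ᵥ v) - 1 / 4 * (w ⬝ᵥ w) ≤ v ⬝ᵥ w := by
  have h := WPTSystem.dotProduct_self_nonneg' (v + (1 / 2 : ℝ) • w)
  simp only [add_dotProduct, dotProduct_add, smul_dotProduct, dotProduct_smul, smul_eq_mul,
    dotProduct_comm w v] at h
  linarith

lemma IsClosedConvex.exists_prox {N : ℕ} {D : Set (Fin N → ℝ)} {F : (Fin N → ℝ) → ℝ}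
    (hF : IsClosedConvex D F) (hD : (interior D).Nonempty) (r a : Fin N → ℝ) :
    ∃ x ∈ D, ∀ y ∈ D, F x + r ⬝ᵥ x + 1 / 2 * ((x - a) ⬝ᵥ (x - a)) ≤
      F y + r ⬝ᵥ y + 1 / 2 * ((y - a) ⬝ᵥ (y - a)) := by
  obtain ⟨x0, hx0⟩ := hD
  obtain ⟨g, hx0D, hg⟩ := hF.convexOn.exists_isSubgradient hx0
  let Φ : (Fin N → ℝ) × ℝ → ℝ := fun q => q.2 + r ⬝ᵥ q.1 + 1 / 2 * ((q.1 - a) ⬝ᵥ (q.1 - a))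
  have hΦ : Continuous Φ := by
    simp only [Φ, dotProduct]; fun_prop
  set c0 := Φ (x0, F x0) with hc0
  let S : Set ((Fin N → ℝ) × ℝ) := {q | q.1 ∈ D ∧ F q.1 ≤ q.2} ∩ {q | Φ q ≤ c0}
  have hScl : IsClosed S := hF.isClosed.inter (isClosed_le hΦ continuous_const)
  set M : ℝ := 4 * (c0 - F x0 - g ⬝ᵥ (a - x0) - r ⬝ᵥ a + (g + r) ⬝ᵥ (g + r)) with hM
  set B : ℝ := 1 / 4 * M with hB
  have hS : S ⊆ Set.Icc (fun n => a n - (1 + M)) (fun n => a n + (1 + M)) ×ˢ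
      Set.Icc (F x0 + g ⬝ᵥ (a - x0) - g ⬝ᵥ g - B) (c0 - r ⬝ᵥ a + r ⬝ᵥ r + B) := by
    rintro ⟨x, t⟩ ⟨⟨hx, hFx⟩, hΦx⟩
    simp only [Set.mem_ofPred_eq, Φ] at hΦx hFx hx
    obtain ⟨w, rfl⟩ : ∃ w, x = a + w := ⟨x - a, by abel⟩
    have h1 := hg _ hx
    have e1 : g ⬝ᵥ (a + w - x0) = g ⬝ᵥ (a - x0) + g ⬝ᵥ w := by
      rw [← dotProduct_add]; congr 1; abel
    rw [e1] at h1
    rw [add_sub_cancel_left, dotProduct_add] at hΦx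
    have h2 := neg_sq_sub_le_dotProduct (g + r) w
    rw [add_dotProduct g r w] at h2
    have h3 := neg_sq_sub_le_dotProduct g w
    have h4 := neg_sq_sub_le_dotProduct r w
    have h0 := WPTSystem.dotProduct_self_nonneg' w
    have hw : w ⬝ᵥ w ≤ M := by rw [hM]; linarith
    have hn : ∀ n, |w n| ≤ 1 + M := fun n => by
      have : w n * w n ≤ w ⬝ᵥ w := Finset.single_le_sum (f := fun n => w n * w n)
        (fun i _ => mul_self_nonneg _) (Finset.mem_univ n)
      have hM0 : 0 ≤ M := h0.trans hw
      refine abs_le_of_sq_le_sq ?_ (by linarith)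
      nlinarith
    refine ⟨⟨fun n => ?_, fun n => ?_⟩, ?_, ?_⟩
    · have := (abs_le.1 (hn n)).1
      simp only [Pi.add_apply]; linarith
    · have := (abs_le.1 (hn n)).2
      simp only [Pi.add_apply]; linarith
    · simp only; linarith
    · simp only; linarith
  have hcomp : IsCompact S := (isCompact_Icc.prod isCompact_Icc).of_isClosed_subset hScl hS
  obtain ⟨⟨x, t⟩, hq, hmin⟩ := hcomp.exists_isMinOn ⟨(x0, F x0), ⟨hx0D, le_rfl⟩, le_refl c0⟩
    hΦ.continuousOn
  refine ⟨x, hq.1.1, fun y hy => ?_⟩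
  have hFx : F x ≤ t := hq.1.2
  have hxt : Φ (x, t) ≤ c0 := hq.2
  have key : Φ (x, t) ≤ Φ (y, F y) := by
    by_cases h : Φ (y, F y) ≤ c0
    · exact hmin ⟨⟨hy, le_rfl⟩, h⟩
    · exact hxt.trans (not_le.1 h).le
  simp only [Φ] at key
  linarith

lemma ConvexOn.isSubgradient_of_prox {N : ℕ} {D : Set (Fin N → ℝ)} {F : (Fin N → ℝ) → ℝ}
    (hF : ConvexOn ℝ D F) {r a x : Fin N → ℝ} {c : ℝ} (hx : x ∈ D)
    (h : ∀ y ∈ D, F x + r ⬝ᵥ x + c * ((x - a) ⬝ᵥ (x - a)) ≤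
      F y + r ⬝ᵥ y + c * ((y - a) ⬝ᵥ (y - a))) :
    IsSubgradient D F x (-(r + (2 * c) • (x - a))) := by
  refine ⟨hx, fun y hy => ?_⟩
  have key : 0 ≤ F y - F x + (r + (2 * c) • (x - a)) ⬝ᵥ (y - x) :=
    nonneg_of_forall_nonneg_add_mul (b := c * ((y - x) ⬝ᵥ (y - x))) fun t ht ht1 => by
      have e : (1 - t) • x + t • y = x + t • (y - x) := by module
      have hc := hF.2 hx hy (sub_nonneg.2 ht1) ht.le (by ring)
      have hm := hF.1 hx hy (sub_nonneg.2 ht1) ht.le (by ring)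
      rw [e] at hc hm
      have h1 := h _ hm
      have e2 : x + t • (y - x) - a = (x - a) + t • (y - x) := by abel
      rw [e2] at h1
      generalize hv : y - x = v at *
      generalize x - a = w at *
      simp only [add_dotProduct, dotProduct_add, smul_dotProduct, dotProduct_smul, smul_eq_mul,
        dotProduct_comm v w] at *
      have : 0 ≤ t * (F y - F x + (r ⬝ᵥ v + 2 * c * (w ⬝ᵥ v)) + t * (c * (v ⬝ᵥ v))) := by
        linarith
      exact nonneg_of_mul_nonneg_right this ht
  rw [neg_dotProduct]
  linarith

lemma IsSubgradient.dotProduct_sub_nonneg {N : ℕ} {D : Set (Fin N → ℝ)} {F : (Fin N → ℝ) → ℝ}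
    {x g x' g' : Fin N → ℝ} (h : IsSubgradient D F x g) (h' : IsSubgradient D F x' g') :
    0 ≤ (g - g') ⬝ᵥ (x - x') := by
  have h1 := h.2 x' h'.1
  have h2 := h'.2 x h.1
  simp only [sub_dotProduct, dotProduct_sub] at *
  linarith

lemma IsSubgradient.eq_of_prox {N : ℕ} {D : Set (Fin N → ℝ)} {F : (Fin N → ℝ) → ℝ}
    {r a x x' : Fin N → ℝ} (h : IsSubgradient D F x (-(r + (x - a))))
    (h' : IsSubgradient D F x' (-(r + (x' - a)))) : x = x' := by
  have h1 := h.dotProduct_sub_nonneg h'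
  have e : -(r + (x - a)) - -(r + (x' - a)) = -(x - x') := by abel
  rw [e, neg_dotProduct] at h1
  have h2 := WPTSystem.dotProduct_self_nonneg' (x - x')
  exact sub_eq_zero.1 (dotProduct_self_eq_zero.1 (by linarith))

/-- A sum of closed convex functions, one of them with compact domain, attains its minimum if
their domains have a common interior point. -/
theorem exists_forall_sum_le {ι : Type*} [Fintype ι] {N : ℕ}
    {D : ι → Set (Fin N → ℝ)} {F : ι → (Fin N → ℝ) → ℝ} (hF : ∀ i, IsClosedConvex (D i) (F i))
    {x0 : Fin N → ℝ} (hx0 : ∀ i, x0 ∈ interior (D i)) {i0 : ι} (hi0 : IsCompact (D i0)) :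
    ∃ xs, (∀ i, xs ∈ D i) ∧ ∀ y, (∀ i, y ∈ D i) → ∑ i, F i xs ≤ ∑ i, F i y := by
  have hx0D : ∀ i, x0 ∈ D i := fun i => interior_subset (hx0 i)
  choose g hg using fun i => (hF i).convexOn.exists_isSubgradient (hx0 i)
  have hL : ∀ i, ∃ L : ℝ, ∀ x ∈ D i0, L ≤ F i x0 + g i ⬝ᵥ (x - x0) := fun i => by
    obtain ⟨L, hL⟩ := (hi0.image_of_continuousOn
      (f := fun x => F i x0 + g i ⬝ᵥ (x - x0)) (by
        simp only [dotProduct]; fun_prop)).bddBelow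
    exact ⟨L, fun x hx => hL ⟨x, hx, rfl⟩⟩
  choose L hL using hL
  set c0 := ∑ i, F i x0
  let S : Set ((Fin N → ℝ) × (ι → ℝ)) :=
    (⋂ i, (fun q => (q.1, q.2 i)) ⁻¹' {q : (Fin N → ℝ) × ℝ | q.1 ∈ D i ∧ F i q.1 ≤ q.2}) ∩
      {q | ∑ i, q.2 i ≤ c0}
  have hScl : IsClosed S := (isClosed_iInter fun i =>
    (hF i).isClosed.preimage (by fun_prop)).inter (isClosed_le (by fun_prop) continuous_const)
  have hmem : ∀ q, q ∈ S ↔ (∀ i, q.1 ∈ D i ∧ F i q.1 ≤ q.2 i) ∧ ∑ i, q.2 i ≤ c0 := fun q => by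
    simp [S]
  have hS : S ⊆ D i0 ×ˢ Set.Icc L (fun i => L i + (c0 - ∑ j, L j)) := by
    rintro ⟨x, t⟩ hq
    obtain ⟨h1, h2⟩ := (hmem _).1 hq
    simp only at h1 h2
    have h3 : ∀ i, L i ≤ t i := fun i =>
      (hL i x (h1 i0).1).trans (((hg i).2 x (h1 i).1).trans (h1 i).2)
    refine ⟨(h1 i0).1, h3, fun i => ?_⟩
    have h4 : t i - L i ≤ ∑ j, (t j - L j) := Finset.single_le_sum (f := fun j => t j - L j)
      (fun j _ => sub_nonneg.2 (h3 j)) (Finset.mem_univ i)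
    rw [Finset.sum_sub_distrib] at h4
    simp only
    linarith
  have hcomp : IsCompact S := (hi0.prod isCompact_Icc).of_isClosed_subset hScl hS
  obtain ⟨⟨x, t⟩, hq, hmin⟩ := hcomp.exists_isMinOn
    ⟨(x0, fun i => F i x0), (hmem _).2 ⟨fun i => ⟨hx0D i, le_rfl⟩, le_rfl⟩⟩
    (f := fun q => ∑ i, q.2 i) (by fun_prop)
  obtain ⟨h1, h2⟩ := (hmem _).1 hq
  refine ⟨x, fun i => (h1 i).1, fun y hy => ?_⟩
  refine (Finset.sum_le_sum fun i _ => (h1 i).2).trans ?_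
  by_cases h : ∑ i, F i y ≤ c0
  · exact hmin ((hmem (y, fun i => F i y)).2 ⟨fun i => ⟨hy i, le_rfl⟩, h⟩)
  · exact h2.trans (not_le.1 h).le

namespace WPTSystem

variable {K N : ℕ} (S : WPTSystem K N)

/-- The effective domain of the valuation of agent `k`, including his own constraints. -/
def effDom (k : Fin (K + 1)) : Set (Fin N → ℝ) :=
  Fin.cases (motive := fun _ => Set (Fin N → ℝ)) S.powerSet
    (fun j => {p | S.received j p ∈ S.dom j}) k

/-- The negative of the valuation of agent `k`, on his effective domain. -/
def negVal (k : Fin (K + 1)) (p : Fin N → ℝ) : ℝ :=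
  Fin.cases (motive := fun _ => ℝ) (S.C p) (fun j => -S.U j (S.received j p)) k

lemma effDom_succ (j : Fin K) : S.effDom j.succ = {p | S.received j p ∈ S.dom j} := rfl

lemma negVal_succ (j : Fin K) : S.negVal j.succ = fun p => -S.U j (S.received j p) := rfl

lemma effDom_subset_feasible (k : Fin (K + 1)) : S.effDom k ⊆ S.feasible k := by
  intro p hp hk
  subst hk
  exact hp

lemma valuation_of_mem {k : Fin (K + 1)} {p : Fin N → ℝ} (hp : p ∈ S.effDom k) :
    S.valuation k p = ((-S.negVal k p : ℝ) : EReal) := by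
  induction k using Fin.cases with
  | zero => rfl
  | succ j =>
    have hp : S.received j p ∈ S.dom j := hp
    simp [valuation, utility, hp, negVal_succ]

lemma valuation_of_notMem {k : Fin (K + 1)} {p : Fin N → ℝ} (hf : p ∈ S.feasible k)
    (hp : p ∉ S.effDom k) : S.valuation k p = ⊥ := by
  induction k using Fin.cases with
  | zero => exact absurd (hf rfl) hp
  | succ j =>
    have hp : S.received j p ∉ S.dom j := hp
    simp [valuation, utility, hp]

lemma payoff_of_mem {k : Fin (K + 1)} {p : Fin N → ℝ} (hp : p ∈ S.effDom k) (t : Fin N → ℝ) :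
    S.payoff k p t = ((-(S.negVal k p + ∑ n, t n) : ℝ) : EReal) := by
  rw [payoff, if_pos (S.effDom_subset_feasible k hp), S.valuation_of_mem hp, ← EReal.coe_sub]
  congr 1
  ring

lemma payoff_of_notMem {k : Fin (K + 1)} {p : Fin N → ℝ} (hp : p ∉ S.effDom k)
    (t : Fin N → ℝ) : S.payoff k p t = ⊥ := by
  rw [payoff]
  split_ifs with hf
  · rw [S.valuation_of_notMem hf hp, EReal.bot_sub]
  · rfl

lemma received_combo (j : Fin K) (a b : ℝ) (x y : Fin N → ℝ) :
    S.received j (a • x + b • y) = a * S.received j x + b * S.received j y := by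
  change S.h j ⬝ᵥ _ = a * (S.h j ⬝ᵥ x) + b * (S.h j ⬝ᵥ y)
  simp [dotProduct_add, dotProduct_smul]

lemma continuous_received (j : Fin K) : Continuous (S.received j) := by
  unfold received; fun_prop

lemma powerSet_subset_nonneg : S.powerSet ⊆ {p | 0 ≤ p} := fun _ hp n => (hp.2 n).1

lemma isClosed_powerSet : IsClosed S.powerSet := by
  have : S.powerSet = {p | ∑ n, p n ≤ S.Pmax} ∩ Set.Icc 0 S.Ppeak := by
    ext p
    simp [powerSet, Pi.le_def, forall_and]
  rw [this]
  exact (isClosed_le (by fun_prop) continuous_const).inter isClosed_Icc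

lemma isCompact_powerSet : IsCompact S.powerSet :=
  (isCompact_Icc (a := (0 : Fin N → ℝ)) (b := S.Ppeak)).of_isClosed_subset S.isClosed_powerSet
    fun _ hp => ⟨fun n => (hp.2 n).1, fun n => (hp.2 n).2⟩

lemma convex_powerSet : Convex ℝ S.powerSet := by
  have : S.powerSet = {p | ∑ n, p n ≤ S.Pmax} ∩ Set.Icc 0 S.Ppeak := by
    ext p
    simp [powerSet, Pi.le_def, forall_and]
  rw [this]
  refine Convex.inter (convex_halfSpace_le ⟨fun x y => ?_, fun c x => ?_⟩ _) (convex_Icc _ _)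
  · simp [Finset.sum_add_distrib]
  · simp [Finset.mul_sum]

variable {S}

lemma Standing.isClosedConvex (hS : S.Standing) (k : Fin (K + 1)) :
    IsClosedConvex (S.effDom k) (S.negVal k) := by
  induction k using Fin.cases with
  | zero =>
    exact ⟨hS.C_convex.subset S.powerSet_subset_nonneg S.convex_powerSet,
      S.isClosed_powerSet.epigraph (hS.C_contDiff.continuousOn.mono S.powerSet_subset_nonneg)⟩
  | succ j =>
    have hU := (hS.U_strictConcave j).concaveOn
    rw [effDom_succ, negVal_succ]
    refine ⟨⟨fun x hx y hy a b ha hb hab => ?_, fun x hx y hy a b ha hb hab => ?_⟩, ?_⟩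
    · change S.received j _ ∈ S.dom j
      rw [received_combo]
      exact hU.1 hx hy ha hb hab
    · simp only [received_combo, smul_eq_mul]
      have := hU.2 hx hy ha hb hab
      simp only [smul_eq_mul] at this
      linarith
    · have h := (hS.U_closed j).IsClosed_hypograph.preimage
        (f := fun q : (Fin N → ℝ) × ℝ => (S.received j q.1, ((-q.2 : ℝ) : EReal)))
        (((S.continuous_received j).comp continuous_fst).prodMk
          (continuous_coe_real_ereal.comp continuous_snd.neg))
      convert h using 1
      ext q
      by_cases hq : S.received j q.1 ∈ S.dom j
      · simp only [Set.mem_ofPred_eq, Set.mem_preimage, utility, hq, if_true, true_and,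
          EReal.coe_le_coe_iff]
        exact neg_le
      · simp [utility, hq]

lemma Standing.exists_mem_interior_effDom (hS : S.Standing) :
    ∃ x0, ∀ k, x0 ∈ interior (S.effDom k) := by
  have hpos : IsOpen {p : Fin N → ℝ | ∀ n, 0 < p n} := by
    simpa only [Set.ofPred_forall] using
      isOpen_iInter_of_finite fun n => isOpen_lt continuous_const (continuous_apply n)
  have hlt : IsOpen {p : Fin N → ℝ | ∀ n, p n < S.Ppeak n} := by
    simpa only [Set.ofPred_forall] using
      isOpen_iInter_of_finite fun n => isOpen_lt (continuous_apply n) continuous_const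
  have hsum : IsOpen {p : Fin N → ℝ | ∑ n, p n < S.Pmax} :=
    isOpen_lt (by fun_prop) continuous_const
  have h1 : ∀ᶠ ε : ℝ in nhdsWithin 0 (Set.Ioi 0), ∀ n, ε < S.Ppeak n :=
    Filter.eventually_all.2 fun n =>
      nhdsWithin_le_nhds (eventually_lt_nhds (hS.Ppeak_pos n))
  have h2 : ∀ᶠ ε : ℝ in nhdsWithin 0 (Set.Ioi 0), (N : ℝ) * ε < S.Pmax := by
    have hc : Continuous fun ε : ℝ => (N : ℝ) * ε := by fun_prop
    refine nhdsWithin_le_nhds ((hc.tendsto 0).eventually (eventually_lt_nhds ?_))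
    simpa using hS.Pmax_pos
  obtain ⟨ε, ⟨h1, h2⟩, h3⟩ := ((h1.and h2).and self_mem_nhdsWithin).exists
  have h3 : 0 < ε := h3
  refine ⟨fun _ => ε, fun k => ?_⟩
  induction k using Fin.cases with
  | zero =>
    refine interior_maximal (s := S.effDom 0) (fun p hp => ?_) ((hsum.inter hpos).inter hlt)
      ⟨⟨by simpa using h2, fun _ => h3⟩, h1⟩
    exact ⟨hp.1.1.le, fun n => ⟨(hp.1.2 n).le, (hp.2 n).le⟩⟩
  | succ j =>
    refine interior_maximal (fun p hp => ?_) hpos (fun _ => h3)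
    change S.received j p ∈ S.dom j
    by_cases h0 : S.h j = 0
    · have : S.received j p = 0 := by simp [received, h0]
      rw [this]
      exact hS.dom_zero j h0
    · obtain ⟨n, hn⟩ := Function.ne_iff.1 h0
      refine hS.dom_pos j (Finset.sum_pos' (fun i _ => mul_nonneg (hS.h_nonneg j i) (hp i).le)
        ⟨n, Finset.mem_univ n, mul_pos (lt_of_le_of_ne (hS.h_nonneg j n) (Ne.symm hn)) (hp n)⟩)

variable (S)

/-- The Karush-Kuhn-Tucker conditions of the reformulated problem: consensus, and each agent
maximizes his valuation minus the payment for his own multipliers. -/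
def IsKKT (π β : AgentVec K N) : Prop :=
  prev π = π ∧ ∀ k, IsSubgradient (S.effDom k) (S.negVal k) (π k) (-(β - next β) k)

lemma exists_sub_next_eq {g : AgentVec K N} (hg : ∑ k, g k = 0) :
    ∃ β : AgentVec K N, -(β - next β) = g := by
  let g' : ℕ → Fin N → ℝ := fun j => if h : j < K + 1 then g ⟨j, h⟩ else 0
  have hg' : ∀ k : Fin (K + 1), g' k = g k := fun k => dif_pos k.isLt
  refine ⟨fun k => ∑ j ∈ Finset.range k, g' j, ?_⟩
  funext k
  simp only [Pi.neg_apply, Pi.sub_apply, next, neg_sub]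
  rw [Fin.val_add_one]
  split_ifs with hk
  · have h1 : ∑ j ∈ Finset.range (K + 1), g' j = 0 := by
      rw [Finset.sum_range, ← hg]
      exact Finset.sum_congr rfl fun i _ => hg' i
    rw [Finset.sum_range_succ] at h1
    have h2 := hg' k
    rw [hk, Fin.val_last] at h2
    rw [hk, Fin.val_last, ← h2, Finset.sum_range_zero, zero_sub]
    exact neg_eq_of_add_eq_zero_right h1
  · rw [Finset.sum_range_succ, hg', add_sub_cancel_left]

variable {S}

theorem Standing.exists_isKKT (hS : S.Standing) : ∃ π β : AgentVec K N, S.IsKKT π β := by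
  obtain ⟨x0, hx0⟩ := hS.exists_mem_interior_effDom
  obtain ⟨xs, hxs, hmin⟩ := exists_forall_sum_le hS.isClosedConvex hx0 (i0 := 0)
    S.isCompact_powerSet
  obtain ⟨g, hg, hsub⟩ := exists_isSubgradient_sum_eq_zero
    (fun k => (hS.isClosedConvex k).convexOn) hx0 hxs hmin
  obtain ⟨β, hβ⟩ := exists_sub_next_eq hg
  refine ⟨fun _ => xs, β, rfl, fun k => ?_⟩
  have : (-(β - next β) k) = g k := congrFun hβ k
  rw [this]
  exact hsub k

end WPTSystem

namespace WPTSystem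

variable {K N : ℕ} {S : WPTSystem K N}

lemma localAugLagrangian_of_mem {ρ : ℝ} {π β : AgentVec K N} {k : Fin (K + 1)}
    (h : π k ∈ S.effDom k) :
    S.localAugLagrangian ρ π β k = ((-(S.negVal k (π k) + π k ⬝ᵥ (β - next β) k
      + ρ / 2 * ((π - prev π) k ⬝ᵥ (π - prev π) k)) : ℝ) : EReal) := by
  rw [localAugLagrangian, S.valuation_of_mem h, ← EReal.coe_sub]
  congr 1
  simp only [dotProduct, Finset.sum_add_distrib, Finset.mul_sum, prev, next, Pi.sub_apply, sq]
  ring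

lemma augLagrangian_of_mem {ρ : ℝ} {π β : AgentVec K N} (h : ∀ k, π k ∈ S.effDom k) :
    S.augLagrangian ρ π β = ((-(∑ k, S.negVal k (π k) + ip π (β - next β)
      + ρ / 2 * ip (π - prev π) (π - prev π)) : ℝ) : EReal) := by
  have hsum : ∀ (f : Fin (K + 1) → ℝ) (s : Finset (Fin (K + 1))),
      ∑ k ∈ s, (f k : EReal) = ((∑ k ∈ s, f k : ℝ) : EReal) := fun f s => by
    classical
    induction s using Finset.induction_on with
    | empty => simp
    | insert a s ha ih => rw [Finset.sum_insert ha, Finset.sum_insert ha, ih, EReal.coe_add]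
  rw [augLagrangian, Finset.sum_congr rfl fun k _ => localAugLagrangian_of_mem (h k), hsum]
  congr 1
  simp only [ip, Finset.sum_neg_distrib, Finset.sum_add_distrib, Finset.mul_sum]

lemma augLagrangian_of_notMem {ρ : ℝ} {π β : AgentVec K N} (h0 : π 0 ∈ S.powerSet)
    {k : Fin (K + 1)} (h : π k ∉ S.effDom k) : S.augLagrangian ρ π β = ⊥ := by
  have hk : S.localAugLagrangian ρ π β k = ⊥ := by
    rw [localAugLagrangian, S.valuation_of_notMem (fun hk0 => by subst hk0; exact h0) h,
      EReal.bot_sub]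
  rw [augLagrangian, ← Finset.add_sum_erase _ _ (Finset.mem_univ k), hk, EReal.bot_add]

lemma ip_sub_next (π β : AgentVec K N) : ip π (β - next β) = ip (π - prev π) β := by
  rw [ip_sub_right, ip_sub_left, ip_next_right]

lemma IsKKT.isSaddlePoint {ρ : ℝ} (hρ : 0 < ρ) {π β : AgentVec K N} (h : S.IsKKT π β) :
    S.IsSaddlePoint ρ π β := by
  obtain ⟨hπ, hsub⟩ := h
  have hz : π - prev π = 0 := by rw [hπ, sub_self]
  have ip_zero : ∀ x : AgentVec K N, ip 0 x = 0 := fun x => by simp [ip]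
  have hmem : ∀ k, π k ∈ S.effDom k := fun k => (hsub k).1
  refine ⟨hmem 0, fun π' h0 => ?_, fun β' => ?_⟩
  · by_cases h' : ∀ k, π' k ∈ S.effDom k
    · rw [augLagrangian_of_mem h', augLagrangian_of_mem hmem, EReal.coe_le_coe_iff, neg_le_neg_iff,
        hz, ip_zero]
      have h1 := Finset.sum_le_sum fun k (_ : k ∈ Finset.univ) => (hsub k).2 (π' k) (h' k)
      rw [Finset.sum_add_distrib] at h1
      have h2 : ∑ k, (-(β - next β) k) ⬝ᵥ (π' k - π k) = ip π (β - next β) - ip π' (β - next β) := by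
        rw [ip_comm π, ip_comm π', ← ip_sub_right, ← neg_sub π' π, ip_neg_right, ← ip_neg_left]
        rfl
      have h3 := mul_nonneg hρ.le (ip_self_nonneg (π' - prev π'))
      linarith
    · push Not at h'
      obtain ⟨k, hk⟩ := h'
      rw [augLagrangian_of_notMem h0 hk]
      exact bot_le
  · rw [augLagrangian_of_mem hmem, augLagrangian_of_mem hmem, ip_sub_next, ip_sub_next, hz,
      ip_zero, ip_zero, ip_zero]

lemma IsSaddlePoint.isKKT (hS : S.Standing) {ρ : ℝ} {π β : AgentVec K N}
    (h : S.IsSaddlePoint ρ π β) : S.IsKKT π β := by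
  classical
  obtain ⟨h0, hmax, hmin⟩ := h
  have hmem : ∀ k, π k ∈ S.effDom k := by
    by_contra! hk
    obtain ⟨k, hk⟩ := hk
    obtain ⟨x0, hx0⟩ := hS.exists_mem_interior_effDom
    have hx : ∀ k, (fun _ => x0 : AgentVec K N) k ∈ S.effDom k := fun k => interior_subset (hx0 k)
    have := hmax (fun _ => x0) (hx 0)
    rw [augLagrangian_of_notMem h0 hk, augLagrangian_of_mem hx, le_bot_iff] at this
    exact EReal.coe_ne_bot _ this
  have hcons : π - prev π = 0 := by
    have h1 := hmin (β + (π - prev π))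
    rw [augLagrangian_of_mem hmem, augLagrangian_of_mem hmem, EReal.coe_le_coe_iff, ip_sub_next,
      ip_sub_next, ip_add_right] at h1
    have h2 : ip (π - prev π) (π - prev π) ≤ 0 := by linarith
    funext k n
    have h3 := sq_le_ip_self (π - prev π) k n
    exact pow_eq_zero_iff (two_ne_zero) |>.1 (le_antisymm (h3.trans h2) (sq_nonneg _))
  have hprev : prev π = π := (sub_eq_zero.1 hcons).symm
  refine ⟨hprev, fun k => ?_⟩
  have key : ∀ y ∈ S.effDom k, S.negVal k (π k) + (β - next β) k ⬝ᵥ π k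
        + 2 * |ρ| * ((π k - π k) ⬝ᵥ (π k - π k)) ≤
      S.negVal k y + (β - next β) k ⬝ᵥ y + 2 * |ρ| * ((y - π k) ⬝ᵥ (y - π k)) := fun y hy => by
    set v := y - π k with hv
    set δ : AgentVec K N := Pi.single k v with hδ
    have hπ' : ∀ j, (π + δ) j ∈ S.effDom j := fun j => by
      by_cases hj : j = k
      · subst hj
        simpa [hδ, hv] using hy
      · simpa [hδ, hj] using hmem j
    have h1 := hmax (π + δ) (hπ' 0)
    have e1 : π + δ - prev (π + δ) = δ - prev δ := by
      rw [prev_add, hprev]; abel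
    rw [augLagrangian_of_mem hmem, augLagrangian_of_mem hπ', EReal.coe_le_coe_iff, e1,
      hcons, ip_add_left] at h1
    have h2 : ∀ z : AgentVec K N, ip δ z = v ⬝ᵥ z k := fun z => by
      rw [ip, Finset.sum_eq_single k (fun j _ hj => by simp [hδ, hj]) (by simp)]
      simp [hδ]
    have h3 : ip (δ - prev δ) (δ - prev δ) ≤ 4 * ip δ δ := by
      have := ip_self_nonneg (δ + prev δ)
      simp only [ip_add_left, ip_add_right, ip_sub_left, ip_sub_right, ip_prev_prev] at *
      linarith
    have h4 : ip δ δ = v ⬝ᵥ v := by rw [h2]; simp [hδ]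
    have h5 : ∑ j, S.negVal j ((π + δ) j) =
        ∑ j, S.negVal j (π j) + (S.negVal k y - S.negVal k (π k)) := by
      rw [← sub_eq_iff_eq_add', ← Finset.sum_sub_distrib,
        Finset.sum_eq_single k (fun j _ hj => by simp [hδ, hj]) (by simp)]
      simp [hδ, hv]
    have h6 : (β - next β) k ⬝ᵥ y = (β - next β) k ⬝ᵥ π k + (β - next β) k ⬝ᵥ v := by
      rw [← dotProduct_add, hv, add_sub_cancel]
    have h7 : ip (0 : AgentVec K N) 0 = 0 := by simp [ip]
    rw [h2, h5, h7, dotProduct_comm v] at h1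
    have h8 : ρ / 2 * ip (δ - prev δ) (δ - prev δ) ≤ 2 * |ρ| * (v ⬝ᵥ v) := by
      rw [h4] at h3
      have h9 := le_abs_self ρ
      have h10 := ip_self_nonneg (δ - prev δ)
      calc ρ / 2 * ip (δ - prev δ) (δ - prev δ) ≤ |ρ| / 2 * ip (δ - prev δ) (δ - prev δ) := by
            gcongr
        _ ≤ |ρ| / 2 * (4 * (v ⬝ᵥ v)) := by gcongr
        _ = _ := by ring
    rw [sub_self, zero_dotProduct, h6]
    linarith
  have := (hS.isClosedConvex k).convexOn.isSubgradient_of_prox (hmem k) key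
  simpa using this

lemma add_two_sub_one (k : Fin (K + 1)) : k + 2 - 1 = k + 1 := by
  have : (2 : Fin (K + 1)) = 1 + 1 := by
    ext; simp [Fin.val_add]
  rw [this, ← add_assoc, add_sub_cancel_right]

lemma eq_const_of_prev_eq {π : AgentVec K N} (h : prev π = π) (k : Fin (K + 1)) : π k = π 0 := by
  induction k using Fin.induction with
  | zero => rfl
  | succ i ih =>
    rw [← ih]
    have h1 := congrFun h i.succ
    rw [← h1, prev, ← Fin.coeSucc_eq_succ, add_sub_cancel_right]

lemma taxRate_messageOf (π β : AgentVec K N) (k : Fin (K + 1)) :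
    taxRate (messageOf π β) k = (β - next β) k := by
  funext n
  simp [taxRate, messageOf, next, add_two_sub_one]

lemma transmitPower_messageOf {π : AgentVec K N} (h : prev π = π) (β : AgentVec K N)
    (k : Fin (K + 1)) : transmitPower (messageOf π β) = π k := by
  funext n
  rw [eq_const_of_prev_eq h k, transmitPower]
  simp only [messageOf, eq_const_of_prev_eq h]
  rw [Finset.sum_const, Finset.card_univ, Fintype.card_fin, nsmul_eq_mul]
  push_cast
  field_simp

lemma taxRate_update (hK : 2 ≤ K) (m : MessageProfile K N) (k : Fin (K + 1))
    (mk : (Fin N → ℝ) × (Fin N → ℝ)) : taxRate (Function.update m k mk) k = taxRate m k := by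
  have h1 : k + 1 ≠ k := by
    rw [Ne, add_eq_left]
    intro h
    have := congrArg Fin.val h
    rw [Fin.val_one', Nat.mod_eq_of_lt (by omega)] at this
    simp at this
  have h2 : k + 2 ≠ k := by
    rw [Ne, add_eq_left]
    intro h
    have := congrArg Fin.val h
    rw [Fin.coe_ofNat_eq_mod, Nat.mod_eq_of_lt (by omega)] at this
    simp at this
  funext n
  simp only [taxRate, Function.update_of_ne h1, Function.update_of_ne h2]

lemma IsKKT.isNashEquilibrium (hK : 2 ≤ K) {π β : AgentVec K N} (h : S.IsKKT π β) :
    S.IsNashEquilibrium (messageOf π β) := by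
  intro k mk
  have hpay : ∀ m : MessageProfile K N, transmitPower m ∈ S.effDom k → S.gamePayoff m k =
      ((-(S.negVal k (transmitPower m) + taxRate m k ⬝ᵥ transmitPower m) : ℝ) : EReal) :=
    fun m hm => S.payoff_of_mem hm _
  by_cases hp : transmitPower (Function.update (messageOf π β) k mk) ∈ S.effDom k
  · have hq := transmitPower_messageOf h.1 β k
    rw [hpay _ hp, hpay _ (by rw [hq]; exact (h.2 k).1),
      taxRate_update hK, taxRate_messageOf, hq]
    have h1 := (h.2 k).2 _ hp
    have h2 : (-(β - next β) k) ⬝ᵥ (transmitPower (Function.update (messageOf π β) k mk) - π k)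
        = (β - next β) k ⬝ᵥ π k
          - (β - next β) k ⬝ᵥ transmitPower (Function.update (messageOf π β) k mk) := by
      rw [neg_dotProduct, dotProduct_sub]; ring
    rw [h2] at h1
    rw [EReal.coe_le_coe_iff, neg_le_neg_iff]
    linarith
  · have : S.gamePayoff (Function.update (messageOf π β) k mk) k = ⊥ := S.payoff_of_notMem hp _
    rw [this]
    exact bot_le

/-- The local maximization of the algorithm as the minimization of a real function. -/
lemma isMaxOn_penalizedPayoff_iff (hS : S.Standing) (m : MessageProfile K N) (k : Fin (K + 1))
    (x : Fin N → ℝ) :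
    (x ∈ S.feasible k ∧ IsMaxOn (S.penalizedPayoff 1 m k) (S.feasible k) x) ↔
      x ∈ S.effDom k ∧ ∀ y ∈ S.effDom k,
        S.negVal k x + taxRate m k ⬝ᵥ x + 1 / 2 * ((x - (m (k - 1)).1) ⬝ᵥ (x - (m (k - 1)).1)) ≤
        S.negVal k y + taxRate m k ⬝ᵥ y
          + 1 / 2 * ((y - (m (k - 1)).1) ⬝ᵥ (y - (m (k - 1)).1)) := by
  have hin : ∀ p ∈ S.effDom k, S.penalizedPayoff 1 m k p = ((-(S.negVal k p + taxRate m k ⬝ᵥ p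
      + 1 / 2 * ((p - (m (k - 1)).1) ⬝ᵥ (p - (m (k - 1)).1))) : ℝ) : EReal) := fun p hp => by
    rw [penalizedPayoff, S.payoff_of_mem hp, ← EReal.coe_sub]
    congr 1
    simp only [dotProduct, Finset.mul_sum, Pi.sub_apply, sq]
    ring
  have hout : ∀ p ∉ S.effDom k, S.penalizedPayoff 1 m k p = ⊥ := fun p hp => by
    rw [penalizedPayoff, S.payoff_of_notMem hp, EReal.bot_sub]
  constructor
  · rintro ⟨hx, hmax⟩
    have hxD : x ∈ S.effDom k := by
      by_contra hxD
      obtain ⟨x0, hx0⟩ := hS.exists_mem_interior_effDom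
      have hx0 := interior_subset (hx0 k)
      have h1 := hmax (S.effDom_subset_feasible k hx0)
      simp only [Set.mem_ofPred_eq, hout x hxD, hin x0 hx0, le_bot_iff] at h1
      exact EReal.coe_ne_bot _ h1
    refine ⟨hxD, fun y hy => ?_⟩
    have h1 := hmax (S.effDom_subset_feasible k hy)
    simp only [Set.mem_ofPred_eq, hin x hxD, hin y hy, EReal.coe_le_coe_iff] at h1
    exact neg_le_neg_iff.1 h1
  · rintro ⟨hx, hmin⟩
    refine ⟨S.effDom_subset_feasible k hx, fun y _ => ?_⟩
    change S.penalizedPayoff 1 m k y ≤ S.penalizedPayoff 1 m k x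
    by_cases hyD : y ∈ S.effDom k
    · rw [hin x hx, hin y hyD, EReal.coe_le_coe_iff]
      exact neg_le_neg (hmin y hyD)
    · rw [hout y hyD]
      exact bot_le

lemma isSubgradient_of_isMaxOn_penalizedPayoff (hS : S.Standing) {m : MessageProfile K N}
    {k : Fin (K + 1)} {x : Fin N → ℝ}
    (h : x ∈ S.feasible k ∧ IsMaxOn (S.penalizedPayoff 1 m k) (S.feasible k) x) :
    IsSubgradient (S.effDom k) (S.negVal k) x (-(taxRate m k + (x - (m (k - 1)).1))) := by
  obtain ⟨hx, hmin⟩ := (isMaxOn_penalizedPayoff_iff hS m k x).1 h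
  have := (hS.isClosedConvex k).convexOn.isSubgradient_of_prox hx hmin
  simpa using this

lemma existsUnique_isStep (hS : S.Standing) (m : MessageProfile K N) :
    ∃! m', S.IsStep 1 (1 / 4) m m' := by
  obtain ⟨x0, hx0⟩ := hS.exists_mem_interior_effDom
  choose x hxD hx using fun k => (hS.isClosedConvex k).exists_prox ⟨x0, hx0 k⟩ (taxRate m k)
    (m (k - 1)).1
  refine ⟨fun k => (fun n => (m k).1 n + 1 / 4 * (x k n - (m k).1 n),
    fun n => (m k).2 n + 1 * (1 / 4) * ((m (k - 1)).1 n - (m (k - 2)).1 n)),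
    ⟨x, fun k => ⟨(isMaxOn_penalizedPayoff_iff hS m k _).2 ⟨hxD k, hx k⟩, fun _ => rfl,
      fun _ => rfl⟩⟩, ?_⟩
  rintro m' ⟨x', hx'⟩
  funext k
  obtain ⟨h1, h2, h3⟩ := hx' k
  have h4 := isSubgradient_of_isMaxOn_penalizedPayoff hS h1
  have h5 := isSubgradient_of_isMaxOn_penalizedPayoff hS
    ((isMaxOn_penalizedPayoff_iff hS m k _).2 ⟨hxD k, hx k⟩)
  have h6 := h4.eq_of_prox h5
  refine Prod.ext (funext fun n => ?_) (funext fun n => h3 n)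
  rw [h2 n, h6]

lemma existsUnique_isRun (hS : S.Standing) (m₀ : MessageProfile K N) :
    ∃! m : ℕ → MessageProfile K N, m 0 = m₀ ∧ S.IsRun 1 (1 / 4) m := by
  choose f hf hfu using fun m => existsUnique_isStep hS m
  refine ⟨fun τ => f^[τ] m₀, ⟨rfl, fun τ => ?_⟩, ?_⟩
  · simp only [Function.iterate_succ_apply']
    exact hf _
  · rintro m ⟨h0, hm⟩
    funext τ
    induction τ with
    | zero => exact h0
    | succ τ ih =>
      rw [Function.iterate_succ_apply', ← ih]
      exact hfu _ _ (hm τ)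

end WPTSystem

namespace WPTSystem

variable {K N : ℕ} {S : WPTSystem K N}

lemma continuous_prev : Continuous (prev : AgentVec K N → AgentVec K N) :=
  continuous_pi fun k => continuous_apply (k - 1)

lemma continuous_next : Continuous (next : AgentVec K N → AgentVec K N) :=
  continuous_pi fun k => continuous_apply (k + 1)

lemma continuous_ip : Continuous fun q : AgentVec K N × AgentVec K N => ip q.1 q.2 := by
  unfold ip dotProduct; fun_prop

lemma continuous_lyap :
    Continuous fun q : AgentVec K N × AgentVec K N × AgentVec K N => lyap q.1 q.2.1 q.2.2 := by
  unfold lyap ip dotProduct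
  simp only [Pi.add_apply, Pi.sub_apply, prev]
  fun_prop

lemma lyap_zero : lyap (0 : AgentVec K N) 0 0 = 0 := by
  have h : ip (0 : AgentVec K N) 0 = 0 := by simp [ip]
  have hp : prev (0 : AgentVec K N) = 0 := rfl
  simp [lyap, h, hp]

lemma tendsto_zero_of_ip_self {x : ℕ → AgentVec K N}
    (h : Filter.Tendsto (fun τ => ip (x τ) (x τ)) Filter.atTop (nhds 0)) :
    Filter.Tendsto x Filter.atTop (nhds 0) := by
  refine tendsto_pi_nhds.2 fun k => tendsto_pi_nhds.2 fun n => ?_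
  have h1 : Filter.Tendsto (fun τ => √(ip (x τ) (x τ))) Filter.atTop (nhds 0) := by
    simpa using h.sqrt
  exact squeeze_zero_norm (fun τ => Real.abs_le_sqrt (sq_le_ip_self (x τ) k n)) h1

lemma mem_Icc_of_ip_self_le {x a : AgentVec K N} {B : ℝ} (h : ip (x - a) (x - a) ≤ B) :
    x ∈ Set.Icc (fun k n => a k n - √B) (fun k n => a k n + √B) := by
  have h1 : ∀ k n, |x k n - a k n| ≤ √B := fun k n =>
    Real.abs_le_sqrt ((sq_le_ip_self (x - a) k n).trans h)
  refine ⟨fun k n => ?_, fun k n => ?_⟩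
  · have := (abs_le.1 (h1 k n)).1; simp only; linarith
  · have := (abs_le.1 (h1 k n)).2; simp only; linarith

/-- The subgradients that the local maximizers `xh` certify, given proposals `x` and
multipliers `β`. -/
def dualSeq (x xh β : AgentVec K N) : AgentVec K N :=
  -((β - next β) + (xh - prev x))

/-- A run of the algorithm in terms of the proposals `x`, the local maximizers `xh` and the
multipliers `β`. -/
structure IsPrimalDualRun (S : WPTSystem K N) (x xh β : ℕ → AgentVec K N) : Prop where
  subgradient : ∀ τ k,
    IsSubgradient (S.effDom k) (S.negVal k) (xh τ k) (dualSeq (x τ) (xh τ) (β τ) k)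
  primal : ∀ τ, x (τ + 1) = x τ + (1 / 4 : ℝ) • (xh τ - x τ)
  dual : ∀ τ, β (τ + 1) = β τ + (1 / 4 : ℝ) • (x τ - prev (x τ))

/-- The Bregman-type divergence of `xs` from `xh` with respect to the subgradients `g`. -/
def bregman (S : WPTSystem K N) (xs xh g : AgentVec K N) : ℝ :=
  ∑ k, S.negVal k (xs k) - ∑ k, S.negVal k (xh k) + ip g (xh - xs)

lemma sum_add_ip_le {x g y : AgentVec K N}
    (h : ∀ k, IsSubgradient (S.effDom k) (S.negVal k) (x k) (g k)) (hy : ∀ k, y k ∈ S.effDom k) :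
    ∑ k, S.negVal k (x k) + ip g (y - x) ≤ ∑ k, S.negVal k (y k) := by
  rw [ip, ← Finset.sum_add_distrib]
  exact Finset.sum_le_sum fun k _ => (h k).2 (y k) (hy k)

namespace IsPrimalDualRun

variable {x xh β : ℕ → AgentVec K N} {π b : AgentVec K N}

/-- The Lyapunov function of a run with respect to the KKT point `(π, b)`. -/
noncomputable def energy (S : WPTSystem K N) (x xh β : ℕ → AgentVec K N) (π b : AgentVec K N)
    (τ : ℕ) : ℝ :=
  lyap (x (τ + 1) - π) (xh τ - x τ) (β (τ + 1) - b)
    + 16 / 5 * bregman S π (xh τ) (dualSeq (x τ) (xh τ) (β τ))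

lemma bregman_nonneg (h : IsPrimalDualRun S x xh β) (hk : S.IsKKT π b) (τ : ℕ) :
    0 ≤ bregman S π (xh τ) (dualSeq (x τ) (xh τ) (β τ)) := by
  have h1 := sum_add_ip_le (h.subgradient τ) (fun k => (hk.2 k).1)
  rw [bregman]
  rw [← neg_sub, ip_neg_right] at h1
  linarith

lemma bregman_le (h : IsPrimalDualRun S x xh β) (hk : S.IsKKT π b) (τ : ℕ) :
    bregman S π (xh τ) (dualSeq (x τ) (xh τ) (β τ)) ≤
      ip (dualSeq (x τ) (xh τ) (β τ) - -(b - next b)) (xh τ - π) := by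
  have h1 := sum_add_ip_le (g := -(b - next b)) hk.2 (fun k => (h.subgradient τ k).1)
  rw [bregman, ip_sub_left]
  linarith

lemma energy_lower (h : IsPrimalDualRun S x xh β) (hk : S.IsKKT π b) (τ : ℕ) :
    3 / 10 * ip (x (τ + 1) - π) (x (τ + 1) - π)
      + 2 * ip (β (τ + 1) + (x (τ + 1) - prev (x (τ + 1))) - b)
          (β (τ + 1) + (x (τ + 1) - prev (x (τ + 1))) - b) ≤ energy S x xh β π b τ := by
  have h1 := lyap_lower (x (τ + 1) - π) (xh τ - x τ) (β (τ + 1) - b)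
  have h2 := h.bregman_nonneg hk τ
  have e : β (τ + 1) - b + (x (τ + 1) - π - prev (x (τ + 1) - π)) =
      β (τ + 1) + (x (τ + 1) - prev (x (τ + 1))) - b := by
    rw [prev_sub, hk.1]; abel
  rw [e] at h1
  rw [energy]
  linarith

lemma energy_nonneg (h : IsPrimalDualRun S x xh β) (hk : S.IsKKT π b) (τ : ℕ) :
    0 ≤ energy S x xh β π b τ := by
  have h1 := h.energy_lower hk τ
  have h2 := ip_self_nonneg (x (τ + 1) - π)
  have h3 := ip_self_nonneg (β (τ + 1) + (x (τ + 1) - prev (x (τ + 1))) - b)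
  linarith

lemma energy_descent (h : IsPrimalDualRun S x xh β) (hk : S.IsKKT π b) (τ : ℕ) :
    energy S x xh β π b (τ + 1) ≤ energy S x xh β π b τ -
      1 / 80 * (ip (x (τ + 1) - prev (x (τ + 1))) (x (τ + 1) - prev (x (τ + 1)))
        + ip (xh (τ + 1) - x (τ + 1)) (xh (τ + 1) - x (τ + 1))) := by
  have h1 := lyap_descent (x (τ + 1) - π) (xh (τ + 1) - x (τ + 1)) (xh τ - x τ) (β (τ + 1) - b)
  have eA : x (τ + 1) - π - prev (x (τ + 1) - π) = x (τ + 1) - prev (x (τ + 1)) := by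
    rw [prev_sub, hk.1]; abel
  have e1 : x (τ + 1) - π + (1 / 4 : ℝ) • (xh (τ + 1) - x (τ + 1)) = x (τ + 1 + 1) - π := by
    rw [h.primal (τ + 1)]; abel
  have e2 : β (τ + 1) - b + (1 / 4 : ℝ) • (x (τ + 1) - prev (x (τ + 1))) =
      β (τ + 1 + 1) - b := by
    rw [h.dual (τ + 1)]; abel
  have e3 : x (τ + 1) - π + (xh (τ + 1) - x (τ + 1)) = xh (τ + 1) - π := by abel
  have ex : x (τ + 1) - π - (1 / 4 : ℝ) • (xh τ - x τ) = x τ - π := by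
    rw [h.primal τ]; abel
  have ex' : x τ - π - prev (x τ - π) = x τ - prev (x τ) := by
    rw [prev_sub, hk.1]; abel
  have e4 : -(xh (τ + 1) - x (τ + 1) - (xh τ - x τ)
      + (1 / 4 : ℝ) • (xh τ - x τ - prev (xh τ - x τ))
      + (1 / 4 : ℝ) • (x τ - prev (x τ) - next (x τ - prev (x τ)))) =
      dualSeq (x (τ + 1)) (xh (τ + 1)) (β (τ + 1)) - dualSeq (x τ) (xh τ) (β τ) := by
    rw [dualSeq, dualSeq, h.dual τ, h.primal τ]
    simp only [prev_add, prev_sub, prev_smul, next_add, next_sub, next_smul]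
    module
  have e5 : -((β (τ + 1) - b) - next (β (τ + 1) - b) + (xh (τ + 1) - x (τ + 1))
      + (x (τ + 1) - prev (x (τ + 1)))) =
      dualSeq (x (τ + 1)) (xh (τ + 1)) (β (τ + 1)) - -(b - next b) := by
    rw [dualSeq, next_sub]; abel
  rw [ex, ex', eA, e1, e2, e3, e4, e5] at h1
  have h2 := (h.bregman_nonneg hk (τ + 1)).trans (h.bregman_le hk (τ + 1))
  have h3 := sum_add_ip_le (h.subgradient τ) (fun k => (h.subgradient (τ + 1) k).1)
  have h4 : bregman S π (xh (τ + 1)) (dualSeq (x (τ + 1)) (xh (τ + 1)) (β (τ + 1)))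
      - bregman S π (xh τ) (dualSeq (x τ) (xh τ) (β τ)) ≤
      ip (dualSeq (x (τ + 1)) (xh (τ + 1)) (β (τ + 1)) - dualSeq (x τ) (xh τ) (β τ))
        (xh (τ + 1) - π) := by
    rw [bregman, bregman, ip_sub_left]
    have e6 : xh (τ + 1) - xh τ = (xh (τ + 1) - π) - (xh τ - π) := by abel
    rw [e6, ip_sub_right] at h3
    linarith
  rw [energy, energy]
  linarith

lemma energy_antitone (h : IsPrimalDualRun S x xh β) (hk : S.IsKKT π b) :
    Antitone (energy S x xh β π b) := antitone_nat_of_succ_le fun τ => by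
  have h1 := h.energy_descent hk τ
  have h2 := ip_self_nonneg (x (τ + 1) - prev (x (τ + 1)))
  have h3 := ip_self_nonneg (xh (τ + 1) - x (τ + 1))
  linarith

lemma tendsto_residuals (h : IsPrimalDualRun S x xh β) (hk : S.IsKKT π b) :
    Filter.Tendsto (fun τ => x (τ + 1) - prev (x (τ + 1))) Filter.atTop (nhds 0) ∧
    Filter.Tendsto (fun τ => xh (τ + 1) - x (τ + 1)) Filter.atTop (nhds 0) := by
  set r : ℕ → ℝ := fun τ => ip (x (τ + 1) - prev (x (τ + 1))) (x (τ + 1) - prev (x (τ + 1)))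
        + ip (xh (τ + 1) - x (τ + 1)) (xh (τ + 1) - x (τ + 1)) with hr
  have hr0 : ∀ τ, 0 ≤ r τ := fun τ => add_nonneg (ip_self_nonneg _) (ip_self_nonneg _)
  have hsum : ∀ n, ∑ τ ∈ Finset.range n, r τ ≤ 80 * energy S x xh β π b 0 := fun n => by
    have : ∑ τ ∈ Finset.range n, r τ ≤
        80 * (energy S x xh β π b 0 - energy S x xh β π b n) := by
      induction n with
      | zero => simp
      | succ n ih =>
        rw [Finset.sum_range_succ]
        have := h.energy_descent hk n
        simp only [hr] at *
        linarith
    linarith [h.energy_nonneg hk n]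
  have hr1 := (summable_of_sum_range_le hr0 hsum).tendsto_atTop_zero
  exact ⟨tendsto_zero_of_ip_self (squeeze_zero (fun τ => ip_self_nonneg _)
      (fun τ => le_add_of_nonneg_right (ip_self_nonneg _)) hr1),
    tendsto_zero_of_ip_self (squeeze_zero (fun τ => ip_self_nonneg _)
      (fun τ => le_add_of_nonneg_left (ip_self_nonneg _)) hr1)⟩

lemma exists_subseq_tendsto (h : IsPrimalDualRun S x xh β) (hk : S.IsKKT π b) :
    ∃ (φ : ℕ → ℕ) (π' b' : AgentVec K N), StrictMono φ ∧
      Filter.Tendsto (fun j => x (φ j + 1)) Filter.atTop (nhds π') ∧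
      Filter.Tendsto (fun j => β (φ j + 1)) Filter.atTop (nhds b') := by
  set E := energy S x xh β π b 0
  have hmem : ∀ τ, (x (τ + 1), β (τ + 1) + (x (τ + 1) - prev (x (τ + 1)))) ∈
      Set.Icc (fun k n => π k n - √(10 / 3 * E)) (fun k n => π k n + √(10 / 3 * E)) ×ˢ
      Set.Icc (fun k n => b k n - √(1 / 2 * E)) (fun k n => b k n + √(1 / 2 * E)) := fun τ => by
    have h1 := (h.energy_lower hk τ).trans (h.energy_antitone hk (Nat.zero_le τ))
    have h2 := ip_self_nonneg (x (τ + 1) - π)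
    have h3 := ip_self_nonneg (β (τ + 1) + (x (τ + 1) - prev (x (τ + 1))) - b)
    exact ⟨mem_Icc_of_ip_self_le (by linarith), mem_Icc_of_ip_self_le (by linarith)⟩
  obtain ⟨⟨π', b'⟩, -, φ, hφ, hlim⟩ := (isCompact_Icc.prod isCompact_Icc).tendsto_subseq hmem
  rw [nhds_prod_eq] at hlim
  refine ⟨φ, π', b', hφ, Filter.tendsto_fst.comp hlim, ?_⟩
  have h1 := (Filter.tendsto_snd.comp hlim).sub
    ((h.tendsto_residuals hk).1.comp hφ.tendsto_atTop)
  simpa [Function.comp_def] using h1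

lemma tendsto_dualSeq_of_subseq {φ : ℕ → ℕ}
    (hx : Filter.Tendsto (fun j => x (φ j + 1)) Filter.atTop (nhds π))
    (hxh : Filter.Tendsto (fun j => xh (φ j + 1)) Filter.atTop (nhds π))
    (hβ : Filter.Tendsto (fun j => β (φ j + 1)) Filter.atTop (nhds b)) (hπ : prev π = π) :
    Filter.Tendsto (fun j => dualSeq (x (φ j + 1)) (xh (φ j + 1)) (β (φ j + 1))) Filter.atTop
      (nhds (-(b - next b))) := by
  have h1 := ((hβ.sub ((continuous_next.tendsto b).comp hβ)).add
    (hxh.sub ((continuous_prev.tendsto π).comp hx))).neg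
  rw [hπ, sub_self, add_zero] at h1
  exact h1

lemma isKKT_of_subseq (hS : S.Standing) (h : IsPrimalDualRun S x xh β) {φ : ℕ → ℕ}
    (hx : Filter.Tendsto (fun j => x (φ j + 1)) Filter.atTop (nhds π))
    (hxh : Filter.Tendsto (fun j => xh (φ j + 1)) Filter.atTop (nhds π))
    (hβ : Filter.Tendsto (fun j => β (φ j + 1)) Filter.atTop (nhds b)) (hπ : prev π = π) :
    S.IsKKT π b := by
  have hg := tendsto_dualSeq_of_subseq hx hxh hβ hπ
  refine ⟨hπ, fun k => ?_⟩
  have hlim : ∀ y, Filter.Tendsto (fun j => (xh (φ j + 1) k, S.negVal k y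
      - dualSeq (x (φ j + 1)) (xh (φ j + 1)) (β (φ j + 1)) k ⬝ᵥ (y - xh (φ j + 1) k)))
      Filter.atTop (nhds (π k, S.negVal k y - (-(b - next b) k) ⬝ᵥ (y - π k))) := fun y => by
    have h1 := tendsto_pi_nhds.1 hxh k
    have h2 := tendsto_pi_nhds.1 hg k
    have hdot : Continuous fun q : (Fin N → ℝ) × (Fin N → ℝ) => q.1 ⬝ᵥ q.2 := by
      unfold dotProduct; fun_prop
    exact h1.prodMk_nhds (tendsto_const_nhds.sub
      ((hdot.tendsto _).comp (h2.prodMk_nhds (tendsto_const_nhds.sub h1))))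
  have hmem : ∀ y ∈ S.effDom k, π k ∈ S.effDom k ∧
      S.negVal k (π k) ≤ S.negVal k y - (-(b - next b) k) ⬝ᵥ (y - π k) := fun y hy =>
    (hS.isClosedConvex k).isClosed.mem_of_tendsto (hlim y) (Filter.Eventually.of_forall fun j =>
      ⟨(h.subgradient _ k).1, by
        have := (h.subgradient (φ j + 1) k).2 y hy
        simp only
        linarith⟩)
  exact ⟨(hmem _ (h.subgradient 0 k).1).1, fun y hy => by linarith [(hmem y hy).2]⟩

/-- Runs of the algorithm converge to a KKT point. -/
theorem exists_tendsto (hS : S.Standing) (h : IsPrimalDualRun S x xh β) :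
    ∃ π b, S.IsKKT π b ∧ Filter.Tendsto x Filter.atTop (nhds π) ∧
      Filter.Tendsto β Filter.atTop (nhds b) := by
  obtain ⟨π₀, b₀, hk₀⟩ := hS.exists_isKKT
  obtain ⟨hA, hd⟩ := h.tendsto_residuals hk₀
  obtain ⟨φ, π, b, hφ, hx, hβ⟩ := h.exists_subseq_tendsto hk₀
  have hAφ := hA.comp hφ.tendsto_atTop
  have hdφ := hd.comp hφ.tendsto_atTop
  have hxh : Filter.Tendsto (fun j => xh (φ j + 1)) Filter.atTop (nhds π) := by
    simpa [Function.comp_def] using hx.add hdφ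
  have hπ : prev π = π := by
    have := tendsto_nhds_unique (hx.sub ((continuous_prev.tendsto π).comp hx)) hAφ
    exact (sub_eq_zero.1 this).symm
  have hk := isKKT_of_subseq hS h hx hxh hβ hπ
  have hg := tendsto_dualSeq_of_subseq hx hxh hβ hπ
  have hbreg : Filter.Tendsto (fun j => bregman S π (xh (φ j + 1))
      (dualSeq (x (φ j + 1)) (xh (φ j + 1)) (β (φ j + 1)))) Filter.atTop (nhds 0) := by
    refine squeeze_zero (fun j => h.bregman_nonneg hk _) (fun j => h.bregman_le hk _) ?_
    have h1 := (continuous_ip.tendsto _).comp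
      ((hg.sub_const (-(b - next b))).prodMk_nhds (hxh.sub_const π))
    have h2 : ip (0 : AgentVec K N) 0 = 0 := by simp [ip]
    simpa [Function.comp_def, h2] using h1
  have hlyap : Filter.Tendsto (fun j => lyap (x (φ j + 1 + 1) - π) (xh (φ j + 1) - x (φ j + 1))
      (β (φ j + 1 + 1) - b)) Filter.atTop (nhds 0) := by
    have h1 : Filter.Tendsto (fun j => x (φ j + 1 + 1) - π) Filter.atTop (nhds 0) := by
      simp only [fun j => h.primal (φ j + 1)]
      simpa using ((hx.add (hdφ.const_smul (1 / 4 : ℝ))).sub_const π)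
    have h2 : Filter.Tendsto (fun j => β (φ j + 1 + 1) - b) Filter.atTop (nhds 0) := by
      simp only [fun j => h.dual (φ j + 1)]
      simpa using ((hβ.add (hAφ.const_smul (1 / 4 : ℝ))).sub_const b)
    have h3 := (continuous_lyap.tendsto _).comp (h1.prodMk_nhds (hdφ.prodMk_nhds h2))
    rw [lyap_zero] at h3
    exact h3
  have hE : Filter.Tendsto (energy S x xh β π b) Filter.atTop (nhds 0) := by
    refine (tendsto_iff_tendsto_subseq_of_antitone (h.energy_antitone hk)
      ((Filter.tendsto_add_atTop_nat 1).comp hφ.tendsto_atTop)).2 ?_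
    have := hlyap.add (hbreg.const_mul (16 / 5))
    simpa [energy, Function.comp_def] using this
  have hx0 : Filter.Tendsto (fun τ => x (τ + 1) - π) Filter.atTop (nhds 0) := by
    refine tendsto_zero_of_ip_self (squeeze_zero (fun τ => ip_self_nonneg _) (fun τ => ?_)
      (by simpa using hE.const_mul (10 / 3)))
    have h1 := h.energy_lower hk τ
    have h3 := ip_self_nonneg (β (τ + 1) + (x (τ + 1) - prev (x (τ + 1))) - b)
    linarith
  have hβ0 : Filter.Tendsto (fun τ => β (τ + 1) + (x (τ + 1) - prev (x (τ + 1))) - b)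
      Filter.atTop (nhds 0) := by
    refine tendsto_zero_of_ip_self (squeeze_zero (fun τ => ip_self_nonneg _) (fun τ => ?_)
      (by simpa using hE.const_mul (1 / 2)))
    have h1 := h.energy_lower hk τ
    have h3 := ip_self_nonneg (x (τ + 1) - π)
    linarith
  refine ⟨π, b, hk, ?_, ?_⟩
  · rw [← Filter.tendsto_add_atTop_iff_nat 1]
    simpa using hx0.add_const π
  · rw [← Filter.tendsto_add_atTop_iff_nat 1]
    simpa using (hβ0.add_const b).sub hA

end IsPrimalDualRun

lemma IsRun.exists_isPrimalDualRun (hS : S.Standing) {m : ℕ → MessageProfile K N}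
    (hm : S.IsRun 1 (1 / 4) m) :
    ∃ xh, IsPrimalDualRun S (fun τ k => (m τ k).1) xh (fun τ k => (m τ (k + 1)).2) := by
  choose xh hxh using hm
  refine ⟨xh, fun τ k => ?_, fun τ => ?_, fun τ => ?_⟩
  · have h1 := isSubgradient_of_isMaxOn_penalizedPayoff hS (hxh τ k).1
    convert h1 using 1
    funext n
    have e : k + 1 + 1 = k + 2 := by
      rw [eq_comm, ← sub_eq_iff_eq_add, add_two_sub_one]
    simp [dualSeq, taxRate, next, prev, e]
  · funext k n
    simpa using (hxh τ k).2.1 n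
  · funext k n
    have e : k + 1 - 2 = k - 1 := by
      rw [sub_eq_iff_eq_add, sub_add_eq_add_sub, add_two_sub_one]
    simpa [prev, e] using (hxh τ (k + 1)).2.2 n

end WPTSystem

theorem theorem5 {K N : ℕ} (hK : 2 ≤ K) (S : WPTSystem K N) (hS : S.Standing) :
    (∀ (ρ : ℝ), 0 < ρ → ∀ π β : AgentVec K N, S.IsSaddlePoint ρ π β →
      S.IsNashEquilibrium (WPTSystem.messageOf π β)) ∧
    (∀ m₀ : MessageProfile K N,
      ∃! m : ℕ → MessageProfile K N, m 0 = m₀ ∧ S.IsRun 1 (1 / 4) m) ∧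
    (∀ m : ℕ → MessageProfile K N, S.IsRun 1 (1 / 4) m →
      ∃ π β : AgentVec K N, S.IsSaddlePoint 1 π β ∧
        Filter.Tendsto m Filter.atTop (nhds (WPTSystem.messageOf π β)) ∧
        S.IsNashEquilibrium (WPTSystem.messageOf π β)) := by
  refine ⟨fun ρ _ π β h => (h.isKKT hS).isNashEquilibrium hK,
    WPTSystem.existsUnique_isRun hS, fun m hm => ?_⟩
  obtain ⟨xh, hrun⟩ := hm.exists_isPrimalDualRun hS
  obtain ⟨π, β, hk, hx, hβ⟩ := hrun.exists_tendsto hS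
  refine ⟨π, β, hk.isSaddlePoint one_pos, tendsto_pi_nhds.2 fun k => ?_,
    hk.isNashEquilibrium hK⟩
  have h1 := tendsto_pi_nhds.1 hx k
  have h2 := tendsto_pi_nhds.1 hβ (k - 1)
  simp only [sub_add_cancel] at h2
  exact h1.prodMk_nhds h2
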